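/- Let $d\ge 2$. A simplicial partition $\triangle$ of a (closed) polyhedral domain $\Omega\subset\mathbb R^d$ is a finite geometric simplicial complex with union $\Omega$ in which every face is a face of a $d$-simplex; below, "simplex" means $d$-simplex of $\triangle$ (a closed set). Let $|\triangle|$ be the largest diameter of a simplex; $\triangle$ is $\beta$-quasi-uniform if $|\triangle|/\rho_T\le\beta$ for all simplices $T$, where $\rho_T$ is the radius of the inscribed ball. Put $\operatorname{star}^0(T)=\{T\}$ and let $\operatorname{star}^{k+1}(T)$ be the set of all simplices that intersect a simplex of $\operatorname{star}^k(T)$; we also write $\operatorname{star}^k(T)$ for the union of its simplices. A simplex $T$ is $L$ simplices away from the boundary if $L$ is the smallest integer for which there are simplices $T=T_1,\dots,T_{L+1}$ with $T_j\cap T_{j+1}\ne\emptyset$ for $1\le j\le L$ and $T_{L+1}\cap\partial\Omega\ne\emptyset$. For $n\ge1$, $r\ge0$ let $S^r_n(\triangle)$ be the space of $C^r$ functions on $\Omega$ that are polynomials of degree at most $n$ on each simplex, and let $\mathcal W=S^r_n(\triangle)\cap H^1_0(\Omega)$ be the subspace of splines vanishing on $\partial\Omega$, with norm $\|u\|_{\mathcal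 W}=\|\nabla u\|_{L^2(\Omega)}$. A basis $\{B_\xi\}_{\xi\in\mathcal M}$ of $\mathcal W$ is called $1$-local with bound $K_1$ if $\|B_\xi\|_\infty\le K_1$ and $\operatorname{supp}B_\xi\subseteq\operatorname{star}^1(T_\xi)$ for some simplex $T_\xi$, for every $\xi$; it is stable with constants $C_1,C_2>0$ if $$C_1\sum_\xi|c_\xi|^2\le\Big\|\sum_\xi c_\xi B_\xi\Big\|_{\mathcal W}^2\le C_2\sum_\xi|c_\xi|^2\qquad\text{for all }(c_\xi).$$ For a vertex ${\bf v}_i$ of $\triangle$ in the interior of $\Omega$, let $h_i\in S^0_1(\triangle)$ be its hat function, equal to $1$ at ${\bf v}_i$ and to $0$ at all other vertices, let $\widetilde\Omega_i$ be the union of $\operatorname{star}^1(t)$ over all simplices $t\subseteq\operatorname{supp}h_i$, and let the discrete interior GBC function $R_i\in\mathcal W$ be the solution of $$\langle\nabla R_i,\nabla w\rangle=-\langle h_i,w\rangle\qquad\text{for all }w\in\mathcal W .$$ **Theorem.** (a) For every interior vertex ${\bf v}_i$ the hat function $h_i$ and the function $R_i$ exist and are unique. (b) If $r=0$, then $\mathcal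 W$ has a basis that is $1$-local with bound $1$ and stable with some constants $C_1,C_2>0$ (which may depend on $\triangle$ and $n$). (c) For every $\kappa$ there is $\sigma\in(0,1)$, depending only on $\kappa$, and for all $d\ge2$, $r\ge0$, $n\ge1$, $\beta$, $\eta$, $K_1$, and $C_1,C_2>0$ with $C_2/C_1\le\kappa$ there is a constant $K>0$, depending only on $d,r,n,\beta,\eta,K_1,C_1,C_2$ (in addition to $\kappa$), such that the following holds. Let $\triangle$ be a $\beta$-quasi-uniform simplicial partition of a polyhedral domain $\Omega\subset\mathbb R^d$ with $|\triangle|\le\eta$, for which $\mathcal W$ has a $1$-local basis with bound $K_1$ that is stable with constants $C_1,C_2$. Let ${\bf v}_i$ be an interior vertex, let ${\bf v}\in\Omega\setminus\widetilde\Omega_i$, let $T$ be a simplex containing ${\bf v}$, let $k\ge1$ be an integer with $\operatorname{star}^k(T)\subseteq\Omega\setminus\widetilde\Omega_i$, and let $T$ be $L$ simplices away from the boundary. Then $$|R_i({\bf v})|\le K\,(L+1)\,\sigma^k .$$ In particular $K$ and $\sigma$ do not depend on $L$, $k$, ${\bf v}$, $T$, ${\bf v}_i$, the domain, or the number of simplices.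 -/

import Mathlib

open MeasureTheory Set

noncomputable section

namespace GBC

/-- The Euclidean space `ℝᵈ`. -/
abbrev E (d : ℕ) : Type := EuclideanSpace ℝ (Fin d)

/-- A simplicial partition of a polyhedral domain in `ℝᵈ`: a finite geometric simplicial complex
in which every face is a face of a `d`-dimensional simplex. -/
structure SimplicialPartition (d : ℕ) where
  complex : Geometry.SimplicialComplex ℝ (E d)
  finite_faces : complex.faces.Finite
  pure : ∀ s ∈ complex.faces, ∃ t ∈ complex.faces, s ⊆ t ∧ t.card = d + 1

/-- The closed simplex spanned by a finite set of vertices. -/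
def cell {d : ℕ} (s : Finset (E d)) : Set (E d) := convexHull ℝ (s : Set (E d))

/-- The radius of the inscribed ball of a simplex: the largest radius of a ball inside it. -/
def inradius {d : ℕ} (s : Finset (E d)) : ℝ :=
  sSup {ρ : ℝ | 0 ≤ ρ ∧ ∃ c : E d, Metric.closedBall c ρ ⊆ cell s}

/-- Two simplices are connected if they, as closed sets, have a point in common. -/
def Touches {d : ℕ} (s t : Finset (E d)) : Prop := (cell s ∩ cell t).Nonempty

namespace SimplicialPartition

variable {d : ℕ} (Δ : SimplicialPartition d)

/-- The (closed) polyhedral domain `Ω` that is partitioned. -/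
def domain : Set (E d) := Δ.complex.space

/-- The `d`-dimensional simplices of the partition, each given by its vertices. -/
def simplices : Set (Finset (E d)) := {T | T ∈ Δ.complex.faces ∧ T.card = d + 1}

/-- The vertices that lie in the interior of the domain. -/
def interiorVertices : Set (E d) := {v | v ∈ Δ.complex.vertices ∧ v ∈ interior Δ.domain}

/-- The mesh size `|Δ|`: the largest diameter of a simplex. -/
def meshSize : ℝ := ⨆ T : Δ.simplices, Metric.diam (cell (T : Finset (E d)))

/-- `β`-quasi-uniformity: `|Δ| / ρ_T ≤ β` for every simplex `T`, with `ρ_T` its inradius. -/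
def QuasiUniform (β : ℝ) : Prop := ∀ T ∈ Δ.simplices, Δ.meshSize / inradius T ≤ β

/-- The simplices of `star^k(T)`: `star^0(T) = {T}`, and `star^(k+1)(T)` consists of the
simplices connected to some simplex of `star^k(T)`. -/
def star (T : Finset (E d)) : ℕ → Set (Finset (E d))
  | 0 => {T}
  | k + 1 => {S | S ∈ Δ.simplices ∧ ∃ U ∈ star T k, Touches S U}

/-- The point set covered by `star^k(T)`. -/
def starRegion (T : Finset (E d)) (k : ℕ) : Set (E d) := ⋃ S ∈ Δ.star T k, cell S

/-- There are simplices `T = c 0, c 1, …, c L`, consecutive ones connected, the last one of which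
meets the boundary of the domain. -/
def HasBoundaryChain (T : Finset (E d)) (L : ℕ) : Prop :=
  ∃ c : ℕ → Finset (E d), c 0 = T ∧ (∀ j ≤ L, c j ∈ Δ.simplices) ∧
    (∀ j < L, Touches (c j) (c (j + 1))) ∧ (cell (c L) ∩ frontier Δ.domain).Nonempty

/-- `T` is `L` simplices away from the boundary: `L` is the least length of a chain of simplices
from `T` to the boundary. -/
def IsSimplicesAway (T : Finset (E d)) (L : ℕ) : Prop := IsLeast {m | Δ.HasBoundaryChain T m} L

/-- The spline space `S^r_n(Δ)`: the functions on the domain that are polynomials of total degree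
at most `n` on each simplex, are continuous on the domain and `r` times continuously
differentiable in its interior.  Functions are extended by `0` outside the domain. -/
def splineSpace (r n : ℕ) : Submodule ℝ (E d → ℝ) where
  carrier := {u | ContinuousOn u Δ.domain ∧ ContDiffOn ℝ r u (interior Δ.domain) ∧
    (∀ T ∈ Δ.simplices, ∃ p : MvPolynomial (Fin d) ℝ, p.totalDegree ≤ n ∧
      ∀ x ∈ cell T, u x = MvPolynomial.eval (fun i => x i) p) ∧
    ∀ x ∉ Δ.domain, u x = 0}
  zero_mem' := ⟨continuousOn_const, contDiffOn_const,
    fun _ _ => ⟨0, by simp, by simp⟩, fun _ _ => rfl⟩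
  add_mem' := by
    rintro u w ⟨hu1, hu2, hu3, hu4⟩ ⟨hw1, hw2, hw3, hw4⟩
    refine ⟨hu1.add hw1, hu2.add hw2, fun T hT => ?_, fun x hx => ?_⟩
    · obtain ⟨p, hp, hpu⟩ := hu3 T hT
      obtain ⟨q, hq, hqw⟩ := hw3 T hT
      refine ⟨p + q, (MvPolynomial.totalDegree_add p q).trans (max_le hp hq), fun x hx => ?_⟩
      simp [hpu x hx, hqw x hx]
    · simp [hu4 x hx, hw4 x hx]
  smul_mem' := by
    rintro a u ⟨hu1, hu2, hu3, hu4⟩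
    refine ⟨hu1.const_smul a, hu2.const_smul a, fun T hT => ?_, fun x hx => ?_⟩
    · obtain ⟨p, hp, hpu⟩ := hu3 T hT
      refine ⟨a • p, (MvPolynomial.totalDegree_smul_le a p).trans hp, fun x hx => ?_⟩
      simp [hpu x hx, MvPolynomial.smul_eval]
    · simp [hu4 x hx]

/-- The space `W = S^r_n(Δ) ∩ H¹₀(Ω)`: the splines that vanish on the boundary (the splines are
continuous and piecewise polynomial, so membership in `H¹₀` means zero boundary values). -/
def splineSpaceZero (r n : ℕ) : Submodule ℝ (E d → ℝ) where
  carrier := {u | u ∈ Δ.splineSpace r n ∧ ∀ x ∈ frontier Δ.domain, u x = 0}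
  zero_mem' := ⟨Submodule.zero_mem _, fun _ _ => rfl⟩
  add_mem' := by
    rintro u w ⟨hu, hu'⟩ ⟨hw, hw'⟩
    exact ⟨Submodule.add_mem _ hu hw, fun x hx => by simp [hu' x hx, hw' x hx]⟩
  smul_mem' := by
    rintro a u ⟨hu, hu'⟩
    exact ⟨Submodule.smul_mem _ a hu, fun x hx => by simp [hu' x hx]⟩

/-- The Dirichlet form `⟨∇u, ∇w⟩ = ∫_Ω ∇u · ∇w`.  A spline is a polynomial inside each simplex, so
the pointwise gradient exists almost everywhere and is the weak gradient. -/
def dirichlet (u w : E d → ℝ) : ℝ := ∫ x in Δ.domain, inner ℝ (gradient u x) (gradient w x)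

/-- `h` is the hat function of the vertex `v`: the continuous piecewise linear function with value
`1` at `v` and `0` at every other vertex. -/
def IsHat (v : E d) (h : E d → ℝ) : Prop :=
  h ∈ Δ.splineSpace 0 1 ∧ h v = 1 ∧ ∀ w ∈ Δ.complex.vertices, w ≠ v → h w = 0

/-- The enlarged support of a hat function `h`: the union of `star^1(t)` over all simplices `t`
contained in the support of `h`. -/
def enlargedSupport (h : E d → ℝ) : Set (E d) :=
  ⋃ t ∈ {t | t ∈ Δ.simplices ∧ cell t ⊆ tsupport h}, Δ.starRegion t 1

/-- `R` is the discrete interior GBC function in `S^r_n(Δ)` of the hat function `h`: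
the weak solution `R ∈ W` of `⟨∇R, ∇w⟩ = -⟨h, w⟩` for all `w ∈ W`. -/
def IsInteriorGBC (r n : ℕ) (h R : E d → ℝ) : Prop :=
  R ∈ Δ.splineSpaceZero r n ∧
    ∀ w ∈ Δ.splineSpaceZero r n, Δ.dirichlet R w = -∫ x in Δ.domain, h x * w x

/-- The basis `B` of `W` is `1`-local and bounded by `K₁`: each basis function is bounded by `K₁`
in absolute value and is supported in `star(T_ξ)` for some simplex `T_ξ`. -/
def IsLocalBasis {r n m : ℕ} (B : Module.Basis (Fin m) ℝ (Δ.splineSpaceZero r n)) (K₁ : ℝ) :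
    Prop :=
  ∀ ξ : Fin m, (∀ x, |(B ξ : E d → ℝ) x| ≤ K₁) ∧
    ∃ T ∈ Δ.simplices, tsupport (B ξ : E d → ℝ) ⊆ Δ.starRegion T 1

/-- The stability of the basis `B` in the norm `‖∇ ·‖_{L²(Ω)}` of `W`, with constants `C₁, C₂`. -/
def IsStableBasis {r n m : ℕ} (B : Module.Basis (Fin m) ℝ (Δ.splineSpaceZero r n)) (C₁ C₂ : ℝ) :
    Prop :=
  ∀ c : Fin m → ℝ,
    C₁ * ∑ ξ, c ξ ^ 2 ≤ Δ.dirichlet (∑ ξ, c ξ • (B ξ : E d → ℝ)) (∑ ξ, c ξ • (B ξ : E d → ℝ)) ∧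
    Δ.dirichlet (∑ ξ, c ξ • (B ξ : E d → ℝ)) (∑ ξ, c ξ • (B ξ : E d → ℝ)) ≤ C₂ * ∑ ξ, c ξ ^ 2

end SimplicialPartition

end GBC

end

/-!
For the decay estimate, expand `R_i = ∑ c_ξ B_ξ`. The vector `c` solves a linear system with the
stiffness matrix `A` of the basis, whose eigenvalues lie in `[C₁, C₂]` by stability and whose entry
at `(ξ, ζ)` vanishes unless `T_ζ` lies in the third star of `T_ξ`, because the basis is local. One
Richardson step `e ↦ e - C₂⁻¹ A e` therefore shrinks the energy `e ⬝ A e` by the factor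
`1 - C₁ / C₂`, while `(A c)_ξ` vanishes for all `ξ` away from the support of `h_i`. Iterating from
`e = c`, the coordinates of `e` near `T` keep their values for about `k / 3` steps, since the
nonzero right-hand side needs that long to reach them, and so these coordinates of `c` are
exponentially small. Quasi-uniformity bounds the number of basis functions involved.

For the basis of continuous splines, let `P_A` be the projection to the subcomplex spanned by a set
`A` of vertices. Extending `u` homogeneously, as `(∑_{v ∈ A} h_v) ^ n * u ∘ P_A`, gives a spline
that changes only on the support of `h_v` when the vertex `v` is added to `A`, and that is `u` once
`A` contains all vertices. So `u` is a sum of splines supported in stars of vertices. Stability is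
automatic in finite dimensions.
-/

namespace GBC

open Filter Topology Matrix

/-! ### Richardson iteration -/

section Richardson

variable {ι : Type*} [Fintype ι]

/-- One step of Richardson's iteration with relaxation parameter `ω` for the homogeneous system
`A x = 0`.  Started from the solution of `A x = b`, it leaves the coordinates far away from the
support of `b` unchanged for as long as the sparsity of `A` permits. -/
def richardsonStep {R : Type*} [Ring R] (A : Matrix ι ι R) (ω : R) (c : ι → R) : ι → R :=
  c - ω • A *ᵥ c

theorem iterate_richardsonStep_apply_eq {R : Type*} [Ring R] {A : Matrix ι ι R} (ω : R) {c : ι → R}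
    {lev : ℕ → Set ι} {m : ℕ} (hlev : ∀ j < m, ∀ ξ ∈ lev j, ∀ η, A ξ η ≠ 0 → η ∈ lev (j + 1))
    (hc : ∀ j < m, ∀ ξ ∈ lev j, (A *ᵥ c) ξ = 0) (j : ℕ) {i : ℕ} (hij : i + j ≤ m) {ξ : ι}
    (hξ : ξ ∈ lev i) : ((richardsonStep A ω)^[j] c) ξ = c ξ := by
  induction j generalizing i ξ with
  | zero => rfl
  | succ j ih =>
    set e := (richardsonStep A ω)^[j] c
    have h_mulVec : (A *ᵥ e) ξ = (A *ᵥ c) ξ := by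
      refine Finset.sum_congr rfl fun η _ => ?_
      by_cases hη : A ξ η = 0
      · simp only [hη, zero_mul]
      · rw [ih (i := i + 1) (by omega) (hlev i (by omega) ξ hξ η hη)]
    rw [Function.iterate_succ_apply']
    simp [richardsonStep, e, h_mulVec, hc i (by omega) ξ hξ, ih (by omega) hξ]

variable {A : Matrix ι ι ℝ} {C₁ C₂ q : ℝ}

theorem mul_energy_le_dotProduct_mulVec (hC₁ : 0 < C₁)
    (hlow : ∀ c, C₁ * (c ⬝ᵥ c) ≤ c ⬝ᵥ A *ᵥ c) (c : ι → ℝ) :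
    C₁ * (c ⬝ᵥ A *ᵥ c) ≤ (A *ᵥ c) ⬝ᵥ (A *ᵥ c) := by
  have h_cauchy : (c ⬝ᵥ A *ᵥ c) ^ 2 ≤ (c ⬝ᵥ c) * ((A *ᵥ c) ⬝ᵥ (A *ᵥ c)) := by
    simpa only [dotProduct, pow_two] using Finset.sum_mul_sq_le_sq_mul_sq Finset.univ c (A *ᵥ c)
  have h_nonneg (x : ι → ℝ) : 0 ≤ x ⬝ᵥ x := dotProduct_self_star_nonneg x
  set e := c ⬝ᵥ A *ᵥ c
  set g := (A *ᵥ c) ⬝ᵥ (A *ᵥ c)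
  rcases (mul_nonneg hC₁.le (h_nonneg c) |>.trans (hlow c)).eq_or_lt with he | he
  · rw [show e = 0 from he.symm, mul_zero]
    exact h_nonneg _
  · refine le_of_mul_le_mul_left ?_ he
    calc e * (C₁ * e) = C₁ * e ^ 2 := by ring
      _ ≤ C₁ * ((c ⬝ᵥ c) * g) := by gcongr
      _ = C₁ * (c ⬝ᵥ c) * g := by ring
      _ ≤ e * g := by gcongr; exacts [h_nonneg _, hlow c]

theorem energy_richardsonStep_le (hA : A.IsSymm) (hC₁ : 0 < C₁) (hC₂ : 0 < C₂)
    (hlow : ∀ c, C₁ * (c ⬝ᵥ c) ≤ c ⬝ᵥ A *ᵥ c) (hup : ∀ c, c ⬝ᵥ A *ᵥ c ≤ C₂ * (c ⬝ᵥ c))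
    (c : ι → ℝ) :
    richardsonStep A C₂⁻¹ c ⬝ᵥ A *ᵥ richardsonStep A C₂⁻¹ c ≤
      (1 - C₁ / C₂) * (c ⬝ᵥ A *ᵥ c) := by
  set b := A *ᵥ c
  have h_symm : c ⬝ᵥ A *ᵥ b = b ⬝ᵥ b := by rw [dotProduct_mulVec, ← mulVec_transpose, hA.eq]
  have h_expand : richardsonStep A C₂⁻¹ c ⬝ᵥ A *ᵥ richardsonStep A C₂⁻¹ c =
      c ⬝ᵥ b - 2 * (C₂⁻¹ * (b ⬝ᵥ b)) + C₂⁻¹ * (C₂⁻¹ * (b ⬝ᵥ A *ᵥ b)) := by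
    simp only [richardsonStep, mulVec_sub, mulVec_smul, sub_dotProduct, dotProduct_sub,
      smul_dotProduct, dotProduct_smul, smul_eq_mul]
    rw [h_symm]
    ring
  have h_quadratic : C₂⁻¹ * (C₂⁻¹ * (b ⬝ᵥ A *ᵥ b)) ≤ C₂⁻¹ * (b ⬝ᵥ b) := by
    gcongr
    exact (inv_mul_le_iff₀ hC₂).2 (hup b)
  have h_gain : C₁ / C₂ * (c ⬝ᵥ b) ≤ C₂⁻¹ * (b ⬝ᵥ b) := by
    rw [div_eq_inv_mul, mul_assoc]
    gcongr
    exact mul_energy_le_dotProduct_mulVec hC₁ hlow c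
  rw [h_expand]
  linarith

theorem energy_iterate_richardsonStep_le (hA : A.IsSymm) (hC₁ : 0 < C₁) (hC₂ : 0 < C₂)
    (hlow : ∀ c, C₁ * (c ⬝ᵥ c) ≤ c ⬝ᵥ A *ᵥ c) (hup : ∀ c, c ⬝ᵥ A *ᵥ c ≤ C₂ * (c ⬝ᵥ c))
    (hq₀ : 0 ≤ q) (hq : 1 - C₁ / C₂ ≤ q) (c : ι → ℝ) (j : ℕ) :
    (richardsonStep A C₂⁻¹)^[j] c ⬝ᵥ A *ᵥ (richardsonStep A C₂⁻¹)^[j] c ≤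
      q ^ j * (c ⬝ᵥ A *ᵥ c) := by
  induction j with
  | zero => simp
  | succ j ih =>
    rw [Function.iterate_succ_apply']
    set e := (richardsonStep A C₂⁻¹)^[j] c
    have he : 0 ≤ e ⬝ᵥ A *ᵥ e :=
      (mul_nonneg hC₁.le (dotProduct_self_star_nonneg e)).trans (hlow e)
    calc _ ≤ (1 - C₁ / C₂) * (e ⬝ᵥ A *ᵥ e) := energy_richardsonStep_le hA hC₁ hC₂ hlow hup e
      _ ≤ q * (q ^ j * (c ⬝ᵥ A *ᵥ c)) := by gcongr
      _ = q ^ (j + 1) * (c ⬝ᵥ A *ᵥ c) := by ring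

theorem sq_mul_sum_sq_le_of_sparse (hA : A.IsSymm) (hC₁ : 0 < C₁) (hC₂ : 0 < C₂)
    (hlow : ∀ c, C₁ * (c ⬝ᵥ c) ≤ c ⬝ᵥ A *ᵥ c) (hup : ∀ c, c ⬝ᵥ A *ᵥ c ≤ C₂ * (c ⬝ᵥ c))
    (hq₀ : 0 ≤ q) (hq : 1 - C₁ / C₂ ≤ q) {c : ι → ℝ} {lev : ℕ → Set ι} {m : ℕ}
    (hlev : ∀ j < m, ∀ ξ ∈ lev j, ∀ η, A ξ η ≠ 0 → η ∈ lev (j + 1))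
    (hc : ∀ j < m, ∀ ξ ∈ lev j, (A *ᵥ c) ξ = 0) {J : Finset ι} (hJ : ∀ ξ ∈ J, ξ ∈ lev 0) :
    C₁ ^ 2 * ∑ ξ ∈ J, c ξ ^ 2 ≤ q ^ m * ((A *ᵥ c) ⬝ᵥ (A *ᵥ c)) := by
  set e := (richardsonStep A C₂⁻¹)^[m] c with he
  have h_restrict : ∑ ξ ∈ J, c ξ ^ 2 ≤ e ⬝ᵥ e :=
    calc ∑ ξ ∈ J, c ξ ^ 2 = ∑ ξ ∈ J, e ξ ^ 2 := Finset.sum_congr rfl fun ξ hξ => by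
          rw [he, iterate_richardsonStep_apply_eq _ hlev hc m (zero_add m).le (hJ ξ hξ)]
      _ ≤ ∑ ξ, e ξ ^ 2 := Finset.sum_le_univ_sum_of_nonneg fun ξ => sq_nonneg (e ξ)
      _ = e ⬝ᵥ e := by simp only [dotProduct, pow_two]
  calc C₁ ^ 2 * ∑ ξ ∈ J, c ξ ^ 2 ≤ C₁ ^ 2 * (e ⬝ᵥ e) := by gcongr
    _ = C₁ * (C₁ * (e ⬝ᵥ e)) := by ring
    _ ≤ C₁ * (q ^ m * (c ⬝ᵥ A *ᵥ c)) := mul_le_mul_of_nonneg_left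
      ((hlow e).trans (energy_iterate_richardsonStep_le hA hC₁ hC₂ hlow hup hq₀ hq c m)) hC₁.le
    _ = q ^ m * (C₁ * (c ⬝ᵥ A *ᵥ c)) := by ring
    _ ≤ q ^ m * ((A *ᵥ c) ⬝ᵥ (A *ᵥ c)) := by
      gcongr
      exact mul_energy_le_dotProduct_mulVec hC₁ hlow c

end Richardson

theorem exists_mul_norm_sq_bounds {V : Type*} [NormedAddCommGroup V] [NormedSpace ℝ V]
    [FiniteDimensional ℝ V] {f : V → ℝ} (hf : Continuous f)
    (hsmul : ∀ (t : ℝ) (x : V), f (t • x) = t ^ 2 * f x) (hpos : ∀ x ≠ 0, 0 < f x) :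
    ∃ C₁ C₂ : ℝ, 0 < C₁ ∧ 0 < C₂ ∧ ∀ x, C₁ * ‖x‖ ^ 2 ≤ f x ∧ f x ≤ C₂ * ‖x‖ ^ 2 := by
  have hzero : f 0 = 0 := by simpa using hsmul 0 0
  rcases subsingleton_or_nontrivial V with hV | hV
  · exact ⟨1, 1, one_pos, one_pos, fun x => by simp [Subsingleton.elim x 0, hzero]⟩
  have hK : IsCompact (Metric.sphere (0 : V) 1) := isCompact_sphere 0 1
  have hne : (Metric.sphere (0 : V) 1).Nonempty := NormedSpace.sphere_nonempty.2 zero_le_one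
  obtain ⟨a, ha, hmin⟩ := hK.exists_isMinOn hne hf.continuousOn
  obtain ⟨b, hb, hmax⟩ := hK.exists_isMaxOn hne hf.continuousOn
  refine ⟨f a, f b, hpos a (ne_zero_of_mem_unit_sphere ⟨a, ha⟩),
    hpos b (ne_zero_of_mem_unit_sphere ⟨b, hb⟩), fun x => ?_⟩
  rcases eq_or_ne x 0 with rfl | hx
  · simp [hzero]
  have hs : ‖x‖⁻¹ • x ∈ Metric.sphere (0 : V) 1 := by
    simp [norm_smul, inv_mul_cancel₀ (norm_ne_zero_iff.2 hx)]
  have hfx : f x = f (‖x‖⁻¹ • x) * ‖x‖ ^ 2 := by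
    rw [hsmul]
    field_simp
  rw [hfx]
  exact ⟨by gcongr; exact hmin hs, by gcongr; exact hmax hs⟩

/-! ### Barycentric coordinates -/

section Simplex

variable {V : Type*}

section Coordinates

variable [AddCommGroup V] [Module ℝ V]

/-- The finite set `T` is the vertex set of a full-dimensional simplex: its points are affinely
independent and span the whole space. -/
def IsFullSimplex (T : Finset V) : Prop :=
  AffineIndependent ℝ ((↑) : T → V) ∧ affineSpan ℝ (T : Set V) = ⊤

namespace IsFullSimplex

variable {T : Finset V}

/-- The affine basis formed by the vertices of a full-dimensional simplex. -/
noncomputable def basis (hT : IsFullSimplex T) : AffineBasis T ℝ V :=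
  ⟨(↑), hT.1, by simpa using hT.2⟩

/-- The barycentric coordinate of the point `v` with respect to the simplex `T`, as an affine
function on the whole space.  It is indexed by all points of the space, and is `0` if `v` is not a
vertex, so that coordinates with respect to different simplices can be compared. -/
noncomputable def coord (hT : IsFullSimplex T) (v : V) : V →ᵃ[ℝ] ℝ :=
  open Classical in if hv : v ∈ T then hT.basis.coord ⟨v, hv⟩ else 0

variable (hT : IsFullSimplex T)

@[simp]
theorem basis_apply (v : T) : hT.basis v = v := rfl

theorem coord_coe (v : T) : hT.coord v = hT.basis.coord v := by simp [coord]

theorem coord_of_notMem {v : V} (hv : v ∉ T) (x : V) : hT.coord v x = 0 := by simp [coord, hv]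

theorem mem_of_coord_ne_zero {v x : V} (h : hT.coord v x ≠ 0) : v ∈ T := by
  by_contra hv
  exact h (hT.coord_of_notMem hv x)

theorem sum_coord (x : V) : ∑ v ∈ T, hT.coord v x = 1 := by
  rw [← Finset.sum_coe_sort T fun v => hT.coord v x]
  simp only [coord_coe]
  exact hT.basis.sum_coord_apply_eq_one x

theorem sum_coord_smul (x : V) : ∑ v ∈ T, hT.coord v x • v = x := by
  rw [← Finset.sum_coe_sort T fun v => hT.coord v x • v]
  simp only [coord_coe]
  exact hT.basis.linear_combination_coord_eq_self x

theorem coord_self {v : V} (hv : v ∈ T) : hT.coord v v = 1 := by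
  rw [hT.coord_coe ⟨v, hv⟩]
  exact hT.basis.coord_apply_eq ⟨v, hv⟩

theorem coord_of_ne {v w : V} (hw : w ∈ T) (hvw : v ≠ w) : hT.coord v w = 0 := by
  by_cases hv : v ∈ T
  · rw [hT.coord_coe ⟨v, hv⟩]
    exact hT.basis.coord_apply_ne (j := ⟨w, hw⟩) (by simpa using hvw)
  · exact hT.coord_of_notMem hv w

theorem coord_combination {s : Finset V} (hs : s ⊆ T) {w : V → ℝ} (hw : ∑ y ∈ s, w y = 1) (v : V) :
    hT.coord v (∑ y ∈ s, w y • y) = (s : Set V).indicator w v := by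
  classical
  rw [← Finset.affineCombination_eq_linear_combination s (fun y => y) w hw,
    Finset.map_affineCombination _ _ _ hw, Finset.affineCombination_eq_linear_combination _ _ _ hw]
  have h_vertex : ∀ y ∈ s, w y • (hT.coord v ∘ fun y => y) y = if y = v then w v else 0 := by
    intro y hy
    by_cases hyv : y = v
    · subst hyv
      simp [hT.coord_self (hs hy)]
    · simp [hT.coord_of_ne (hs hy) (Ne.symm hyv), hyv]
  rw [Finset.sum_congr rfl h_vertex, Finset.sum_ite_eq' s v]
  simp [Set.indicator]

theorem coord_nonneg {x : V} (hx : x ∈ convexHull ℝ (T : Set V)) (v : V) : 0 ≤ hT.coord v x := by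
  obtain ⟨w, hw₀, hw₁, rfl⟩ := Finset.mem_convexHull'.1 hx
  rw [hT.coord_combination subset_rfl hw₁]
  exact Set.indicator_nonneg hw₀ v

theorem coord_le_one {x : V} (hx : x ∈ convexHull ℝ (T : Set V)) (v : V) : hT.coord v x ≤ 1 := by
  by_cases hv : v ∈ T
  · rw [← hT.sum_coord x]
    exact Finset.single_le_sum (f := fun v => hT.coord v x) (fun w _ => hT.coord_nonneg hx w) hv
  · rw [hT.coord_of_notMem hv]
    exact zero_le_one

theorem mem_convexHull_of_coord_nonneg {x : V} (hx : ∀ v ∈ T, 0 ≤ hT.coord v x) :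
    x ∈ convexHull ℝ (T : Set V) :=
  Finset.mem_convexHull'.2 ⟨fun v => hT.coord v x, hx, hT.sum_coord x, hT.sum_coord_smul x⟩

theorem mem_convexHull_of_carrier_subset {S : Finset V} {x : V}
    (hx : x ∈ convexHull ℝ (T : Set V)) (hS : ∀ v, hT.coord v x ≠ 0 → v ∈ S) :
    x ∈ convexHull ℝ (S : Set V) := by
  classical
  have h_carrier : T.filter (fun v => hT.coord v x ≠ 0) ⊆ S := fun v hv =>
    hS v (Finset.mem_filter.1 hv).2
  refine convexHull_mono (Finset.coe_subset.2 h_carrier) (Finset.mem_convexHull'.2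
    ⟨fun v => hT.coord v x, fun v _ => hT.coord_nonneg hx v, ?_, ?_⟩)
  · rw [Finset.sum_filter_ne_zero, hT.sum_coord]
  · rw [Finset.sum_filter_of_ne fun v _ hv => (smul_ne_zero_iff.1 hv).1, hT.sum_coord_smul]

theorem exists_mem_openSegment {x y : V} (hx : x ∈ convexHull ℝ (T : Set V))
    (hxy : ∀ v, hT.coord v x = 0 → hT.coord v y = 0) :
    ∃ z ∈ convexHull ℝ (T : Set V), (∀ v, hT.coord v x = 0 → hT.coord v z = 0) ∧
      x ∈ openSegment ℝ y z := by
  obtain ⟨t, ht, hz⟩ : ∃ t : ℝ, 1 < t ∧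
      ∀ v ∈ T, 0 ≤ AffineMap.lineMap (hT.coord v y) (hT.coord v x) t := by
    have h_all : ∀ᶠ t : ℝ in 𝓝[>] 1, ∀ v ∈ T,
        0 ≤ AffineMap.lineMap (hT.coord v y) (hT.coord v x) t := by
      refine (Filter.eventually_all_finset T).2 fun v _ => ?_
      rcases (hT.coord_nonneg hx v).eq_or_lt with h0 | hpos
      · simp [← h0, hxy v h0.symm]
      · refine nhdsWithin_le_nhds ((AffineMap.lineMap_continuous.tendsto _).eventually_const_le ?_)
        simpa using hpos
    obtain ⟨t, ht, ht'⟩ := (h_all.and self_mem_nhdsWithin).exists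
    exact ⟨t, ht', ht⟩
  refine ⟨AffineMap.lineMap y x t, hT.mem_convexHull_of_coord_nonneg fun v hv => ?_,
    fun v hv => ?_, ?_⟩
  · rw [AffineMap.apply_lineMap]
    exact hz v hv
  · rw [AffineMap.apply_lineMap, hv, hxy v hv, AffineMap.lineMap_same_apply]
  · rw [openSegment_eq_image_lineMap]
    refine ⟨t⁻¹, ⟨by positivity, inv_lt_one_of_one_lt₀ ht⟩, ?_⟩
    rw [AffineMap.lineMap_lineMap_right, inv_mul_cancel₀ (by positivity),
      AffineMap.lineMap_apply_one]

end IsFullSimplex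

end Coordinates

section Topology

variable [NormedAddCommGroup V] [NormedSpace ℝ V]

theorem IsFullSimplex.interior_convexHull {T : Finset V} (hT : IsFullSimplex T) :
    interior (convexHull ℝ (T : Set V)) = {x | ∀ v ∈ T, 0 < hT.coord v x} := by
  have h_range : range hT.basis = (T : Set V) := by
    ext
    simp
  rw [← h_range, hT.basis.interior_convexHull]
  ext x
  simp [← hT.coord_coe]

theorem IsFullSimplex.closure_interior_convexHull [FiniteDimensional ℝ V] {T : Finset V}
    (hT : IsFullSimplex T) :
    closure (interior (convexHull ℝ (T : Set V))) = convexHull ℝ (T : Set V) := by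
  rw [(convex_convexHull ℝ _).closure_interior_eq_closure_of_nonempty_interior
    (interior_convexHull_nonempty_iff_affineSpan_eq_top.2 hT.2),
    (T.finite_toSet.isCompact_convexHull ℝ).isClosed.closure_eq]

theorem eventually_mem_imp_mem {ι X : Type*} [TopologicalSpace X] {I : Set ι} (hI : I.Finite)
    {C : ι → Set X} (hC : ∀ i ∈ I, IsClosed (C i)) (y : X) :
    ∀ᶠ z in 𝓝 y, ∀ i ∈ I, z ∈ C i → y ∈ C i := by
  rw [Filter.eventually_all_finite hI]
  intro i hi
  by_cases hy : y ∈ C i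
  · exact .of_forall fun _ _ => hy
  · filter_upwards [(hC i hi).isOpen_compl.mem_nhds hy] with z hz hzC
    exact absurd hzC hz

theorem mem_interior_biUnion_of_mem_openSegment {ι : Type*} {I : Set ι} (hI : I.Finite)
    {C : ι → Set V} (h_closed : ∀ i ∈ I, IsClosed (C i)) (h_convex : ∀ i ∈ I, Convex ℝ (C i))
    {x y z : V} (hy : y ∈ interior (⋃ i ∈ I, C i)) (hz : ∀ i ∈ I, y ∈ C i → z ∈ C i)
    (hx : x ∈ openSegment ℝ y z) : x ∈ interior (⋃ i ∈ I, C i) := by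
  rw [openSegment_symm, openSegment_eq_image_lineMap] at hx
  obtain ⟨t, ht, rfl⟩ := hx
  have h_image := (AffineMap.homothety_isOpenMap z t ht.1.ne').image_mem_nhds
    ((eventually_mem_imp_mem hI h_closed y).and (isOpen_interior.mem_nhds hy))
  rw [AffineMap.homothety_eq_lineMap] at h_image
  rw [mem_interior_iff_mem_nhds]
  filter_upwards [h_image]
  rintro _ ⟨p, ⟨hpy, hp⟩, rfl⟩
  obtain ⟨i, hi, hpi⟩ := mem_iUnion₂.1 (interior_subset hp)
  rw [AffineMap.homothety_eq_lineMap]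
  exact mem_iUnion₂.2 ⟨i, hi,
    (h_convex i hi).lineMap_mem (hz i hi (hpy i hi hpi)) hpi ⟨ht.1.le, ht.2.le⟩⟩

end Topology

end Simplex

/-! ### Simplicial partitions and hat functions -/

variable {d : ℕ}

theorem isCompact_cell (s : Finset (E d)) : IsCompact (cell s) :=
  s.finite_toSet.isCompact_convexHull ℝ

theorem convex_cell (s : Finset (E d)) : Convex ℝ (cell s) := convex_convexHull ℝ _

theorem mem_cell_of_mem {s : Finset (E d)} {v : E d} (hv : v ∈ s) : v ∈ cell s :=
  subset_convexHull ℝ _ hv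

namespace SimplicialPartition

variable (Δ : SimplicialPartition d)

theorem finite_simplices : Δ.simplices.Finite := Δ.finite_faces.subset fun _ h => h.1

theorem domain_eq : Δ.domain = ⋃ T ∈ Δ.simplices, cell T := by
  ext x
  simp only [domain, Geometry.SimplicialComplex.mem_space_iff, mem_iUnion, exists_prop]
  constructor
  · rintro ⟨s, hs, hx⟩
    obtain ⟨t, ht, hst, hc⟩ := Δ.pure s hs
    exact ⟨t, ⟨ht, hc⟩, convexHull_mono (Finset.coe_subset.2 hst) hx⟩
  · rintro ⟨T, hT, hx⟩
    exact ⟨T, hT.1, hx⟩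

theorem isCompact_domain : IsCompact Δ.domain := by
  rw [domain_eq]
  exact Δ.finite_simplices.isCompact_biUnion fun T _ => isCompact_cell T

variable {Δ}

theorem mem_domain_iff {x : E d} : x ∈ Δ.domain ↔ ∃ T ∈ Δ.simplices, x ∈ cell T := by
  simp [domain_eq]

section simplices

variable {S T : Finset (E d)} (hT : T ∈ Δ.simplices)
include hT

theorem cell_subset_domain : cell T ⊆ Δ.domain := fun _ hx => mem_domain_iff.2 ⟨T, hT, hx⟩

theorem mem_vertices_of_mem {v : E d} (hv : v ∈ T) : v ∈ Δ.complex.vertices :=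
  Δ.complex.down_closed hT.1 (by simpa using hv) (by simp)

theorem isFullSimplex : IsFullSimplex T := by
  have h_indep := Δ.complex.indep hT.1
  exact ⟨h_indep, by simpa [hT.2] using h_indep.affineSpan_eq_top_iff_card_eq_finrank_add_one⟩

theorem interior_cell_nonempty : (interior (cell T)).Nonempty :=
  interior_convexHull_nonempty_iff_affineSpan_eq_top.2 (isFullSimplex hT).2

theorem closure_interior_cell : closure (interior (cell T)) = cell T :=
  (isFullSimplex hT).closure_interior_convexHull

theorem coord_eq_coord (hS : S ∈ Δ.simplices) {x : E d} (hxT : x ∈ cell T) (hxS : x ∈ cell S)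
    (v : E d) : (isFullSimplex hT).coord v x = (isFullSimplex hS).coord v x := by
  classical
  have h_inter := Δ.complex.inter_subset_convexHull hT.1 hS.1 ⟨hxT, hxS⟩
  rw [← Finset.coe_inter] at h_inter
  obtain ⟨w, -, hw, rfl⟩ := Finset.mem_convexHull'.1 h_inter
  rw [(isFullSimplex hT).coord_combination Finset.inter_subset_left hw,
    (isFullSimplex hS).coord_combination Finset.inter_subset_right hw]

end simplices

theorem exists_simplex_of_mem_vertices {v : E d} (hv : v ∈ Δ.complex.vertices) :
    ∃ T ∈ Δ.simplices, v ∈ T := by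
  obtain ⟨t, ht, hst, hc⟩ := Δ.pure {v} hv
  exact ⟨t, ⟨ht, hc⟩, by simpa using hst⟩

variable (Δ) in
/-- The hat function of a vertex `v`: on each simplex it is the barycentric coordinate of `v`. -/
noncomputable def hat (v x : E d) : ℝ :=
  open Classical in
  if h : ∃ T ∈ Δ.simplices, x ∈ cell T then (isFullSimplex h.choose_spec.1).coord v x else 0

theorem hat_eq_coord {T : Finset (E d)} (hT : T ∈ Δ.simplices) {x : E d} (hx : x ∈ cell T)
    (v : E d) : Δ.hat v x = (isFullSimplex hT).coord v x := by
  have h : ∃ T ∈ Δ.simplices, x ∈ cell T := ⟨T, hT, hx⟩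
  rw [hat, dif_pos h]
  exact coord_eq_coord h.choose_spec.1 hT h.choose_spec.2 hx v

theorem hat_of_notMem {x : E d} (hx : x ∉ Δ.domain) (v : E d) : Δ.hat v x = 0 := by
  rw [hat, dif_neg (by rwa [← mem_domain_iff])]

theorem hat_nonneg (v x : E d) : 0 ≤ Δ.hat v x := by
  by_cases hx : x ∈ Δ.domain
  · obtain ⟨T, hT, hxT⟩ := mem_domain_iff.1 hx
    rw [hat_eq_coord hT hxT]
    exact (isFullSimplex hT).coord_nonneg hxT v
  · rw [hat_of_notMem hx]

theorem hat_le_one (v x : E d) : Δ.hat v x ≤ 1 := by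
  by_cases hx : x ∈ Δ.domain
  · obtain ⟨T, hT, hxT⟩ := mem_domain_iff.1 hx
    rw [hat_eq_coord hT hxT]
    exact (isFullSimplex hT).coord_le_one hxT v
  · rw [hat_of_notMem hx]
    exact zero_le_one

theorem exists_cell_of_hat_ne_zero {v x : E d} (hx : Δ.hat v x ≠ 0) :
    ∃ T ∈ Δ.simplices, x ∈ cell T := by
  rw [← mem_domain_iff]
  by_contra hxd
  exact hx (hat_of_notMem hxd v)

theorem mem_of_hat_ne_zero {T : Finset (E d)} (hT : T ∈ Δ.simplices) {v x : E d} (hx : x ∈ cell T)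
    (h : Δ.hat v x ≠ 0) : v ∈ T :=
  (isFullSimplex hT).mem_of_coord_ne_zero (x := x) (by rwa [← hat_eq_coord hT hx])

/-- If `y` were an interior point, then so would be the points `y'` close to `y` on the way to `x`,
which have the same carrier as `x`.  From `y'` one can move through `x` to some `z` inside this
carrier, and every simplex containing `y'` contains `z`, so that the homotheties centred at `z`
carry a neighbourhood of `y'` in the domain to a neighbourhood of `x`. -/
theorem mem_frontier_of_carrier_subset {T : Finset (E d)} (hT : T ∈ Δ.simplices) {x y : E d}
    (hx : x ∈ cell T) (hy : y ∈ cell T) (hxf : x ∈ frontier Δ.domain)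
    (hxy : ∀ v, Δ.hat v x = 0 → Δ.hat v y = 0) : y ∈ frontier Δ.domain := by
  simp only [hat_eq_coord hT hx, hat_eq_coord hT hy] at hxy
  rw [Δ.isCompact_domain.isClosed.frontier_eq] at hxf ⊢
  refine ⟨cell_subset_domain hT hy, fun hyi => hxf.2 ?_⟩
  set b := (isFullSimplex hT).coord
  obtain ⟨ε, hεi, hε⟩ : ∃ ε : ℝ, AffineMap.lineMap y x ε ∈ interior Δ.domain ∧ ε ∈ Ioo 0 1 := by
    have h_near : ∀ᶠ ε : ℝ in 𝓝[>] 0, AffineMap.lineMap y x ε ∈ interior Δ.domain := by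
      refine nhdsWithin_le_nhds (AffineMap.lineMap_continuous.continuousAt.eventually_mem ?_)
      simpa using isOpen_interior.mem_nhds hyi
    exact (h_near.and (Ioo_mem_nhdsGT one_pos)).exists
  set y' : E d := AffineMap.lineMap y x ε with hy'
  have hy'T : y' ∈ cell T := (convex_cell T).lineMap_mem hy hx (Ioo_subset_Icc_self hε)
  have h_coord (v : E d) : b v y' = (1 - ε) * b v y + ε * b v x := by
    rw [hy', AffineMap.apply_lineMap, AffineMap.lineMap_apply_module]
    rfl
  have h_carrier (v : E d) : b v y' = 0 ↔ b v x = 0 := by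
    refine ⟨fun h => ?_, fun h => by simp [h_coord, h, hxy v h]⟩
    have hbx := (isFullSimplex hT).coord_nonneg hx v
    have hby := (isFullSimplex hT).coord_nonneg hy v
    nlinarith [h_coord v, mul_nonneg (sub_pos.2 hε.2).le hby, hε.1]
  obtain ⟨z, hzT, hz, hxz⟩ := (isFullSimplex hT).exists_mem_openSegment hx
    fun v => (h_carrier v).2
  rw [domain_eq] at hεi ⊢
  refine mem_interior_biUnion_of_mem_openSegment Δ.finite_simplices
    (fun S _ => (isCompact_cell S).isClosed) (fun S _ => convex_cell S) hεi
    (fun S hS hyS => (isFullSimplex hT).mem_convexHull_of_carrier_subset hzT fun v hv => ?_) hxz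
  refine (isFullSimplex hS).mem_of_coord_ne_zero (x := y') ?_
  rw [← coord_eq_coord hT hS hy'T hyS]
  exact fun h => hv (hz v ((h_carrier v).1 h))

end SimplicialPartition

/-! ### Spline spaces -/

theorem contDiff_mvPolynomial_eval (p : MvPolynomial (Fin d) ℝ) {k : WithTop ℕ∞} :
    ContDiff ℝ k fun x : E d => MvPolynomial.eval (fun i => x i) p :=
  (AnalyticOnNhd.eval_linearMap' (fun i => (EuclideanSpace.proj i : E d →L[ℝ] ℝ).toLinearMap)
    p).contDiff

theorem exists_eval_eq_affineMap (f : E d →ᵃ[ℝ] ℝ) :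
    ∃ p : MvPolynomial (Fin d) ℝ, p.totalDegree ≤ 1 ∧
      ∀ x : E d, f x = MvPolynomial.eval (fun i => x i) p := by
  refine ⟨∑ i, MvPolynomial.C (f.linear (EuclideanSpace.single i 1)) * MvPolynomial.X i +
    MvPolynomial.C (f 0), ?_, fun x => ?_⟩
  · refine (MvPolynomial.totalDegree_add _ _).trans (max_le ?_ (by simp))
    refine MvPolynomial.totalDegree_finsetSum_le fun i _ => ?_
    exact (MvPolynomial.totalDegree_mul _ _).trans (by simp)
  · have hx : f.linear x = f.linear (∑ i, x i • EuclideanSpace.single i (1 : ℝ)) :=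
      congrArg _ (by ext j; simp [Finset.sum_apply, Pi.single_apply])
    rw [congrFun f.decomp x, Pi.add_apply, hx]
    simp [mul_comm]

theorem exists_affineMap_eq_eval (p : MvPolynomial (Fin d) ℝ) (hp : p.totalDegree ≤ 1) :
    ∃ f : E d →ᵃ[ℝ] ℝ, ∀ x : E d, f x = MvPolynomial.eval (fun i => x i) p := by
  rw [← MvPolynomial.mem_restrictTotalDegree, MvPolynomial.restrictTotalDegree,
    MvPolynomial.restrictSupport_eq_span] at hp
  induction hp using Submodule.span_induction with
  | zero => exact ⟨0, by simp⟩
  | add p q _ _ hp hq =>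
    obtain ⟨f, hf⟩ := hp
    obtain ⟨g, hg⟩ := hq
    exact ⟨f + g, by simp [hf, hg]⟩
  | smul a p _ hp =>
    obtain ⟨f, hf⟩ := hp
    exact ⟨a • f, by simp [hf, MvPolynomial.smul_eval]⟩
  | mem p hp =>
    obtain ⟨m, hm : m.degree ≤ 1, rfl⟩ := hp
    rcases Nat.le_one_iff_eq_zero_or_eq_one.1 hm with h_const | h_linear
    · rw [Finsupp.degree_eq_zero_iff] at h_const
      subst h_const
      exact ⟨AffineMap.const ℝ (E d) 1, by simp⟩
    · obtain ⟨i, rfl⟩ : m ∈ range fun i => Finsupp.single i 1 := by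
        rwa [Finsupp.range_single_one]
      refine ⟨(EuclideanSpace.proj i : E d →L[ℝ] ℝ).toLinearMap.toAffineMap, fun x => ?_⟩
      simp [MvPolynomial.eval_monomial]

/-- On the set `s`, the function `u` agrees with a polynomial of total degree at most `n`. -/
def PolynomialOn (n : ℕ) (s : Set (E d)) (u : E d → ℝ) : Prop :=
  ∃ p : MvPolynomial (Fin d) ℝ, p.totalDegree ≤ n ∧
    ∀ x ∈ s, u x = MvPolynomial.eval (fun i => x i) p

theorem PolynomialOn.continuousOn {n : ℕ} {s : Set (E d)} {u : E d → ℝ} (hu : PolynomialOn n s u) :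
    ContinuousOn u s := by
  obtain ⟨p, -, hp⟩ := hu
  exact (contDiff_mvPolynomial_eval p (k := 0)).continuous.continuousOn.congr hp

theorem PolynomialOn.congr {n : ℕ} {s : Set (E d)} {u w : E d → ℝ} (hu : PolynomialOn n s u)
    (h : EqOn w u s) : PolynomialOn n s w := by
  obtain ⟨p, hpn, hp⟩ := hu
  exact ⟨p, hpn, fun x hx => (h hx).trans (hp x hx)⟩

theorem polynomialOn_affineMap (f : E d →ᵃ[ℝ] ℝ) (s : Set (E d)) : PolynomialOn 1 s f := by
  obtain ⟨p, hpn, hp⟩ := exists_eval_eq_affineMap f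
  exact ⟨p, hpn, fun x _ => hp x⟩

namespace SimplicialPartition

variable {Δ : SimplicialPartition d} {r n : ℕ} {u : E d → ℝ}

theorem polynomialOn_of_mem_splineSpace (hu : u ∈ Δ.splineSpace r n) {T : Finset (E d)}
    (hT : T ∈ Δ.simplices) : PolynomialOn n (cell T) u := hu.2.2.1 T hT

theorem eq_zero_of_notMem_domain (hu : u ∈ Δ.splineSpace r n) {x : E d} (hx : x ∉ Δ.domain) :
    u x = 0 := hu.2.2.2 x hx

theorem eq_zero_of_mem_frontier (hu : u ∈ Δ.splineSpaceZero r n) {x : E d}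
    (hx : x ∈ frontier Δ.domain) : u x = 0 := hu.2 x hx

theorem continuousOn_domain_of_polynomialOn (hu : ∀ T ∈ Δ.simplices, PolynomialOn n (cell T) u) :
    ContinuousOn u Δ.domain := by
  have : Finite Δ.simplices := Δ.finite_simplices
  rw [domain_eq, biUnion_eq_iUnion]
  exact (locallyFinite_of_finite _).continuousOn_iUnion
    (fun T => (isCompact_cell _).isClosed) fun T => (hu T T.2).continuousOn

theorem mem_splineSpace_zero (hu : ∀ T ∈ Δ.simplices, PolynomialOn n (cell T) u)
    (h_zero : ∀ x ∉ Δ.domain, u x = 0) : u ∈ Δ.splineSpace 0 n :=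
  have h_cont := continuousOn_domain_of_polynomialOn hu
  ⟨h_cont, contDiffOn_zero.2 (h_cont.mono interior_subset), hu, h_zero⟩

theorem isHat_hat {v : E d} (hv : v ∈ Δ.complex.vertices) : Δ.IsHat v (Δ.hat v) := by
  refine ⟨mem_splineSpace_zero (fun T hT => ?_) fun x hx => hat_of_notMem hx v, ?_,
    fun w hw hwv => ?_⟩
  · exact (polynomialOn_affineMap ((isFullSimplex hT).coord v) _).congr
      fun x hx => hat_eq_coord hT hx v
  · obtain ⟨T, hT, hvT⟩ := exists_simplex_of_mem_vertices hv
    rw [hat_eq_coord hT (mem_cell_of_mem hvT), (isFullSimplex hT).coord_self hvT]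
  · obtain ⟨T, hT, hwT⟩ := exists_simplex_of_mem_vertices hw
    rw [hat_eq_coord hT (mem_cell_of_mem hwT), (isFullSimplex hT).coord_of_ne hwT hwv.symm]

theorem IsHat.eqOn_coord {v : E d} {h : E d → ℝ} (hh : Δ.IsHat v h) {T : Finset (E d)}
    (hT : T ∈ Δ.simplices) : EqOn h ((isFullSimplex hT).coord v) (cell T) := by
  obtain ⟨h_spline, h_one, h_zero⟩ := hh
  obtain ⟨p, hpn, hp⟩ := polynomialOn_of_mem_splineSpace h_spline hT
  obtain ⟨f, hf⟩ := exists_affineMap_eq_eval p hpn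
  have hfb : f = (isFullSimplex hT).coord v := by
    refine AffineMap.ext_on (isFullSimplex hT).2 fun w hw => ?_
    rw [hf, ← hp w (mem_cell_of_mem hw)]
    by_cases hwv : w = v
    · subst hwv
      rw [h_one, (isFullSimplex hT).coord_self hw]
    · rw [h_zero w (mem_vertices_of_mem hT hw) hwv,
        (isFullSimplex hT).coord_of_ne hw (Ne.symm hwv)]
  intro x hx
  rw [hp x hx, ← hf, hfb]

theorem IsHat.eq_hat {v : E d} {h : E d → ℝ} (hh : Δ.IsHat v h) : h = Δ.hat v := by
  ext x
  by_cases hx : x ∈ Δ.domain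
  · obtain ⟨T, hT, hxT⟩ := mem_domain_iff.1 hx
    rw [hh.eqOn_coord hT hxT, hat_eq_coord hT hxT]
  · rw [eq_zero_of_notMem_domain hh.1 hx, hat_of_notMem hx]

theorem existsUnique_isHat {v : E d} (hv : v ∈ Δ.complex.vertices) : ∃! h, Δ.IsHat v h :=
  ⟨Δ.hat v, isHat_hat hv, fun _ hh => hh.eq_hat⟩

theorem continuous_of_mem_splineSpaceZero (hu : u ∈ Δ.splineSpaceZero r n) : Continuous u := by
  have h_outside : EqOn u 0 (closure Δ.domainᶜ) := fun x hx => by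
    by_cases hxd : x ∈ Δ.domain
    · refine eq_zero_of_mem_frontier hu ?_
      rw [frontier_eq_closure_inter_closure]
      exact ⟨subset_closure hxd, hx⟩
    · exact eq_zero_of_notMem_domain hu.1 hxd
  have h_univ : Δ.domain ∪ closure Δ.domainᶜ = univ :=
    eq_univ_of_forall fun x => (em (x ∈ Δ.domain)).imp_right fun h => subset_closure h
  rw [← continuousOn_univ, ← h_univ]
  exact hu.1.1.union_of_isClosed (continuousOn_const.congr h_outside)
    Δ.isCompact_domain.isClosed isClosed_closure

end SimplicialPartition

/-- The functions that are given by polynomials of degree at most `n` on each of the simplices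
in `𝒯` and vanish elsewhere, parametrized by the polynomials; on the overlap of simplices, one of
the polynomials is used. -/
noncomputable def glue (𝒯 : Finset (Finset (E d))) (n : ℕ) :
    (𝒯 → MvPolynomial.restrictTotalDegree (Fin d) ℝ n) →ₗ[ℝ] (E d → ℝ) where
  toFun p x := open Classical in if h : ∃ T : 𝒯, x ∈ cell (T : Finset (E d)) then
    MvPolynomial.eval (fun i => x i) (p h.choose : MvPolynomial (Fin d) ℝ) else 0
  map_add' p q := by
    ext x
    by_cases h : ∃ T : 𝒯, x ∈ cell (T : Finset (E d)) <;> simp [h]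
  map_smul' a p := by
    ext x
    by_cases h : ∃ T : 𝒯, x ∈ cell (T : Finset (E d)) <;> simp [h, MvPolynomial.smul_eval]

theorem mem_range_glue {n : ℕ} {𝒯 : Finset (Finset (E d))} {u : E d → ℝ}
    (hu : ∀ T ∈ 𝒯, PolynomialOn n (cell T) u) (h_zero : ∀ x, (∀ T ∈ 𝒯, x ∉ cell T) → u x = 0) :
    u ∈ LinearMap.range (glue 𝒯 n) := by
  choose! p hpn hp using hu
  refine ⟨fun T => ⟨p T, (MvPolynomial.mem_restrictTotalDegree _ _ _).2 (hpn T T.2)⟩, ?_⟩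
  ext x
  by_cases hx : ∃ T : 𝒯, x ∈ cell (T : Finset (E d))
  · simp only [glue, LinearMap.coe_mk, AddHom.coe_mk, dif_pos hx]
    exact (hp _ hx.choose.2 x hx.choose_spec).symm
  · simp only [glue, LinearMap.coe_mk, AddHom.coe_mk, dif_neg hx]
    push Not at hx
    exact (h_zero x fun T hT => hx ⟨T, hT⟩).symm

theorem finrank_range_glue_le (𝒯 : Finset (Finset (E d))) (n : ℕ) :
    Module.finrank ℝ (LinearMap.range (glue 𝒯 n)) ≤
      𝒯.card * Module.finrank ℝ (MvPolynomial.restrictTotalDegree (Fin d) ℝ n) := by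
  refine (LinearMap.finrank_range_le _).trans ?_
  rw [Module.finrank_pi_fintype]
  simp

theorem SimplicialPartition.splineSpaceZero_le_range_glue (Δ : SimplicialPartition d) (r n : ℕ) :
    Δ.splineSpaceZero r n ≤ LinearMap.range (glue Δ.finite_simplices.toFinset n) := by
  refine fun u hu => mem_range_glue
    (fun T hT => polynomialOn_of_mem_splineSpace hu.1 (by simpa using hT)) fun x hx => ?_
  refine eq_zero_of_notMem_domain hu.1 fun hxd => ?_
  obtain ⟨T, hT, hxT⟩ := mem_domain_iff.1 hxd
  exact hx T (by simpa using hT) hxT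

instance SimplicialPartition.finiteDimensional_splineSpaceZero (Δ : SimplicialPartition d)
    (r n : ℕ) : FiniteDimensional ℝ (Δ.splineSpaceZero r n) :=
  Submodule.finiteDimensional_of_le (Δ.splineSpaceZero_le_range_glue r n)

/-! ### The Dirichlet form -/

section Gradient

variable {F : Type*} [NormedAddCommGroup F] [InnerProductSpace ℝ F] [CompleteSpace F]
  {f g : F → ℝ} {x : F}

theorem continuous_gradient (hf : ContDiff ℝ 1 f) : Continuous (gradient f) :=
  (InnerProductSpace.toDual ℝ F).symm.continuous.comp (hf.continuous_fderiv one_ne_zero)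

theorem gradient_add (hf : DifferentiableAt ℝ f x) (hg : DifferentiableAt ℝ g x) :
    gradient (f + g) x = gradient f x + gradient g x := by
  simp [gradient, fderiv_add hf hg]

theorem gradient_const_smul (hf : DifferentiableAt ℝ f x) (a : ℝ) :
    gradient (a • f) x = a • gradient f x := by
  simp [gradient, fderiv_const_smul hf a]

end Gradient

theorem ae_mem_interior_cell (T : Finset (E d)) :
    ∀ᵐ x ∂volume.restrict (cell T), x ∈ interior (cell T) := by
  rw [ae_restrict_iff' (isCompact_cell T).measurableSet]
  have h_frontier : ∀ᵐ x : E d, x ∉ frontier (cell T) :=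
    measure_eq_zero_iff_ae_notMem.1 ((convex_cell T).addHaar_frontier volume)
  filter_upwards [h_frontier] with x hx hxT
  by_contra hxi
  exact hx ((isCompact_cell T).isClosed.frontier_eq ▸ ⟨hxT, hxi⟩)

namespace SimplicialPartition

variable {Δ : SimplicialPartition d} {r n : ℕ} {u w : E d → ℝ} {T : Finset (E d)}

theorem ae_restrict_domain_iff {P : E d → Prop} :
    (∀ᵐ x ∂volume.restrict Δ.domain, P x) ↔
      ∀ T ∈ Δ.simplices, ∀ᵐ x ∂volume.restrict (cell T), P x := by
  rw [domain_eq]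
  exact ae_restrict_biUnion_iff _ Δ.finite_simplices.countable _

theorem ae_restrict_domain_of_interior {P : E d → Prop}
    (hP : ∀ T ∈ Δ.simplices, ∀ x ∈ interior (cell T), P x) :
    ∀ᵐ x ∂volume.restrict Δ.domain, P x :=
  ae_restrict_domain_iff.2 fun T hT => (ae_mem_interior_cell T).mono (hP T hT)

theorem exists_contDiff_eqOn (hu : u ∈ Δ.splineSpace r n) (hT : T ∈ Δ.simplices) :
    ∃ f : E d → ℝ, ContDiff ℝ 1 f ∧ EqOn u f (cell T) := by
  obtain ⟨p, -, hp⟩ := polynomialOn_of_mem_splineSpace hu hT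
  exact ⟨_, contDiff_mvPolynomial_eval p, hp⟩

theorem eventuallyEq_of_eqOn_cell (h : EqOn u w (cell T)) {x : E d} (hx : x ∈ interior (cell T)) :
    u =ᶠ[𝓝 x] w :=
  h.eventuallyEq_of_mem (mem_interior_iff_mem_nhds.1 hx)

theorem differentiableAt_of_mem_interior (hu : u ∈ Δ.splineSpace r n) (hT : T ∈ Δ.simplices)
    {x : E d} (hx : x ∈ interior (cell T)) : DifferentiableAt ℝ u x := by
  obtain ⟨f, hf, huf⟩ := exists_contDiff_eqOn hu hT
  exact (hf.differentiable one_ne_zero x).congr_of_eventuallyEq (eventuallyEq_of_eqOn_cell huf hx)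

theorem integrableOn_inner_gradient (hu : u ∈ Δ.splineSpace r n) (hw : w ∈ Δ.splineSpace r n) :
    IntegrableOn (fun x => inner ℝ (gradient u x) (gradient w x)) Δ.domain := by
  rw [domain_eq, integrableOn_finite_biUnion Δ.finite_simplices]
  intro T hT
  obtain ⟨f, hf, huf⟩ := exists_contDiff_eqOn hu hT
  obtain ⟨g, hg, hwg⟩ := exists_contDiff_eqOn hw hT
  have h_cont : Continuous fun x => inner ℝ (gradient f x) (gradient g x) :=
    (continuous_gradient hf).inner (continuous_gradient hg)
  refine (h_cont.continuousOn.integrableOn_compact (isCompact_cell T)).congr ?_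
  filter_upwards [ae_mem_interior_cell T] with x hx
  rw [(eventuallyEq_of_eqOn_cell huf hx).gradient_eq,
    (eventuallyEq_of_eqOn_cell hwg hx).gradient_eq]

theorem dirichlet_comm (u w : E d → ℝ) : Δ.dirichlet u w = Δ.dirichlet w u := by
  simp only [dirichlet, real_inner_comm]

theorem dirichlet_add_left {u' : E d → ℝ} (hu : u ∈ Δ.splineSpace r n)
    (hu' : u' ∈ Δ.splineSpace r n) (hw : w ∈ Δ.splineSpace r n) :
    Δ.dirichlet (u + u') w = Δ.dirichlet u w + Δ.dirichlet u' w := by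
  rw [dirichlet, dirichlet, dirichlet, ← integral_add (integrableOn_inner_gradient hu hw)
    (integrableOn_inner_gradient hu' hw)]
  refine integral_congr_ae (ae_restrict_domain_of_interior fun T hT x hx => ?_)
  simp only [gradient_add (differentiableAt_of_mem_interior hu hT hx)
    (differentiableAt_of_mem_interior hu' hT hx), inner_add_left]

theorem dirichlet_smul_left (hu : u ∈ Δ.splineSpace r n) (a : ℝ) (w : E d → ℝ) :
    Δ.dirichlet (a • u) w = a * Δ.dirichlet u w := by
  rw [dirichlet, dirichlet, ← integral_const_mul]
  refine integral_congr_ae (ae_restrict_domain_of_interior fun T hT x hx => ?_)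
  simp only [gradient_const_smul (differentiableAt_of_mem_interior hu hT hx), real_inner_smul_left]

variable (Δ r n) in
/-- The Dirichlet form as a bilinear form on the splines with zero boundary values. -/
noncomputable def dirichletForm : LinearMap.BilinForm ℝ (Δ.splineSpaceZero r n) :=
  LinearMap.mk₂ ℝ (fun u w => Δ.dirichlet u w)
    (fun u u' w => dirichlet_add_left u.2.1 u'.2.1 w.2.1)
    (fun a u w => dirichlet_smul_left u.2.1 a w)
    (fun u w w' => by
      simp only [dirichlet_comm (u : E d → ℝ)]
      exact dirichlet_add_left w.2.1 w'.2.1 u.2.1)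
    (fun a u w => by
      simp only [dirichlet_comm (u : E d → ℝ)]
      exact dirichlet_smul_left w.2.1 a u)

theorem dirichletForm_apply (u w : Δ.splineSpaceZero r n) :
    Δ.dirichletForm r n u w = Δ.dirichlet u w := rfl

theorem dirichlet_self_nonneg (u : E d → ℝ) : 0 ≤ Δ.dirichlet u u :=
  integral_nonneg fun _ => real_inner_self_nonneg

theorem exists_eqOn_const_of_dirichlet_self_eq_zero (hu : u ∈ Δ.splineSpace r n)
    (h_energy : Δ.dirichlet u u = 0) (hT : T ∈ Δ.simplices) :
    ∃ a, EqOn u (fun _ => a) (cell T) := by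
  obtain ⟨f, hf, huf⟩ := exists_contDiff_eqOn hu hT
  have h_ae : ∀ᵐ x ∂volume.restrict Δ.domain, inner ℝ (gradient u x) (gradient u x) = 0 :=
    (integral_eq_zero_iff_of_nonneg (fun _ => real_inner_self_nonneg)
      (integrableOn_inner_gradient hu hu)).1 h_energy
  have h_ae_interior : gradient f =ᵐ[volume.restrict (interior (cell T))] fun _ => 0 := by
    filter_upwards [ae_restrict_of_ae_restrict_of_subset interior_subset
      (ae_restrict_domain_iff.1 h_ae T hT), ae_restrict_mem isOpen_interior.measurableSet]
      with x hx hxi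
    rwa [inner_self_eq_zero, (eventuallyEq_of_eqOn_cell huf hxi).gradient_eq] at hx
  have h_gradient : EqOn (gradient f) (fun _ => 0) (interior (cell T)) :=
    Measure.eqOn_open_of_ae_eq h_ae_interior isOpen_interior
      (continuous_gradient hf).continuousOn continuousOn_const
  obtain ⟨a, ha⟩ := isOpen_interior.exists_is_const_of_fderiv_eq_zero (𝕜 := ℝ)
    (convex_cell T).interior.isPreconnected (hf.differentiable one_ne_zero).differentiableOn
    fun x hx => by simpa [gradient] using h_gradient hx
  refine ⟨a, fun x hx => (huf hx).trans ?_⟩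
  rw [← closure_interior_cell hT] at hx
  exact closure_minimal (t := {x | f x = a}) ha (isClosed_eq hf.continuous continuous_const) hx

theorem finite_range_of_dirichlet_self_eq_zero (hu : u ∈ Δ.splineSpace r n)
    (h_energy : Δ.dirichlet u u = 0) : (range u).Finite := by
  have h_range : range u ⊆ insert 0 (⋃ T ∈ Δ.simplices, u '' cell T) := by
    rintro _ ⟨x, rfl⟩
    by_cases hx : x ∈ Δ.domain
    · obtain ⟨T, hT, hxT⟩ := mem_domain_iff.1 hx
      exact Or.inr (mem_iUnion₂.2 ⟨T, hT, x, hxT, rfl⟩)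
    · exact Or.inl (eq_zero_of_notMem_domain hu hx)
  refine (Finite.insert 0 (Δ.finite_simplices.biUnion fun T hT => ?_)).subset h_range
  obtain ⟨a, ha⟩ := exists_eqOn_const_of_dirichlet_self_eq_zero hu h_energy hT
  refine (finite_singleton a).subset ?_
  rintro _ ⟨x, hx, rfl⟩
  exact ha hx

theorem eq_zero_of_dirichlet_self_eq_zero [Nontrivial (E d)] (hu : u ∈ Δ.splineSpaceZero r n)
    (h_energy : Δ.dirichlet u u = 0) : u = 0 := by
  have h_range : (range u).Subsingleton :=
    (finite_range_of_dirichlet_self_eq_zero hu.1 h_energy).countable.isTotallyDisconnected _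
      subset_rfl (isPreconnected_range (continuous_of_mem_splineSpaceZero hu))
  obtain ⟨y, hy⟩ := (ne_univ_iff_exists_notMem _).1 Δ.isCompact_domain.ne_univ
  ext x
  rw [h_range ⟨x, rfl⟩ ⟨y, rfl⟩, eq_zero_of_notMem_domain hu.1 hy, Pi.zero_apply]

theorem nondegenerate_dirichletForm [Nontrivial (E d)] : (Δ.dirichletForm r n).Nondegenerate := by
  have h_symm : (Δ.dirichletForm r n).IsSymm := ⟨fun u w => dirichlet_comm _ _⟩
  refine h_symm.isRefl.nondegenerate_iff_separatingLeft.2 fun u hu => ?_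
  exact Subtype.ext (eq_zero_of_dirichlet_self_eq_zero u.2 (hu u))

theorem integrableOn_mul {f g : E d → ℝ} (hf : ContinuousOn f Δ.domain)
    (hg : ContinuousOn g Δ.domain) : IntegrableOn (fun x => f x * g x) Δ.domain :=
  (hf.mul hg).integrableOn_compact Δ.isCompact_domain

variable (Δ r n) in
/-- The functional `w ↦ -⟨h, w⟩` on the splines with zero boundary values, that is, the right-hand
side of the variational problem solved by the GBC function of `h`. -/
noncomputable def load {h : E d → ℝ} (hh : ContinuousOn h Δ.domain) :
    Module.Dual ℝ (Δ.splineSpaceZero r n) where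
  toFun w := -∫ x in Δ.domain, h x * (w : E d → ℝ) x
  map_add' w w' := by
    rw [← neg_add, ← integral_add (integrableOn_mul hh w.2.1.1) (integrableOn_mul hh w'.2.1.1)]
    simp [mul_add]
  map_smul' a w := by
    simp only [RingHom.id_apply, smul_eq_mul, mul_neg, ← integral_const_mul]
    simp [mul_left_comm]

theorem existsUnique_isInteriorGBC [Nontrivial (E d)] {h : E d → ℝ}
    (hh : ContinuousOn h Δ.domain) : ∃! R, Δ.IsInteriorGBC r n h R := by
  set e := (Δ.dirichletForm r n).toDual nondegenerate_dirichletForm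
  refine ⟨e.symm (Δ.load r n hh), ⟨Subtype.prop _, fun w hw => ?_⟩, fun R hR => ?_⟩
  · exact LinearMap.BilinForm.apply_toDual_symm_apply (hB := nondegenerate_dirichletForm)
      (Δ.load r n hh) ⟨w, hw⟩
  · have hR_load : e ⟨R, hR.1⟩ = Δ.load r n hh := LinearMap.ext fun w => hR.2 w w.2
    rw [← hR_load, e.symm_apply_apply]

end SimplicialPartition

/-! ### Stars -/

theorem card_mul_pow_finrank_le_of_pairwiseDisjoint_ball {ι F : Type*} [NormedAddCommGroup F]
    [NormedSpace ℝ F] [FiniteDimensional ℝ F] {s : Finset ι} {c : ι → F} {x : F} {ρ r : ℝ}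
    (hρ : 0 < ρ) (hr : 0 ≤ r)
    (h_disjoint : (s : Set ι).PairwiseDisjoint fun i => Metric.ball (c i) ρ)
    (h_subset : ∀ i ∈ s, Metric.ball (c i) ρ ⊆ Metric.closedBall x r) :
    s.card * ρ ^ Module.finrank ℝ F ≤ r ^ Module.finrank ℝ F := by
  borelize F
  set μ : Measure F := Measure.addHaar
  have h_measure : ∑ i ∈ s, μ (Metric.ball (c i) ρ) ≤ μ (Metric.closedBall x r) := by
    rw [← measure_biUnion_finset h_disjoint fun i _ => measurableSet_ball]
    exact measure_mono (iUnion₂_subset h_subset)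
  simp only [Measure.addHaar_ball_of_pos μ _ hρ, Measure.addHaar_closedBall μ _ hr,
    Finset.sum_const, nsmul_eq_mul, ← mul_assoc] at h_measure
  rwa [ENNReal.mul_le_mul_iff_left (Metric.measure_ball_pos μ 0 one_pos).ne'
      measure_ball_lt_top.ne, ← ENNReal.ofReal_natCast, ← ENNReal.ofReal_mul s.card.cast_nonneg,
    ENNReal.ofReal_le_ofReal_iff (by positivity)] at h_measure

theorem card_le_of_linearIndependent_of_polynomialOn {ι : Type*} {n : ℕ} {b : ι → E d → ℝ}
    (hb : LinearIndependent ℝ b) {I : Finset ι} {𝒯 : Finset (Finset (E d))}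
    (h_poly : ∀ ξ ∈ I, ∀ T ∈ 𝒯, PolynomialOn n (cell T) (b ξ))
    (h_zero : ∀ ξ ∈ I, ∀ x, (∀ T ∈ 𝒯, x ∉ cell T) → b ξ x = 0) :
    I.card ≤ 𝒯.card * Module.finrank ℝ (MvPolynomial.restrictTotalDegree (Fin d) ℝ n) := by
  have h_range (ξ : I) : b ξ ∈ LinearMap.range (glue 𝒯 n) :=
    mem_range_glue (h_poly ξ ξ.2) (h_zero ξ ξ.2)
  have h_indep : LinearIndependent ℝ fun ξ : I =>
      (⟨b ξ, h_range ξ⟩ : LinearMap.range (glue 𝒯 n)) :=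
    .of_comp (Submodule.subtype _) (hb.comp ((↑) : I → ι) Subtype.val_injective)
  simpa using h_indep.fintype_card_le_finrank.trans (finrank_range_glue_le 𝒯 n)

theorem Touches.symm {S T : Finset (E d)} (h : Touches S T) : Touches T S := by
  rwa [Touches, inter_comm]

theorem touches_of_mem {S T : Finset (E d)} {x : E d} (hS : x ∈ cell S) (hT : x ∈ cell T) :
    Touches S T :=
  ⟨x, hS, hT⟩

theorem le_diam_cell_of_closedBall_subset [Nontrivial (E d)] {T : Finset (E d)} {c : E d} {ρ : ℝ}
    (hρ : 0 ≤ ρ) (hc : Metric.closedBall c ρ ⊆ cell T) : 2 * ρ ≤ Metric.diam (cell T) := by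
  rw [← Metric.diam_closedBall_eq c hρ]
  exact Metric.diam_mono hc (isCompact_cell T).isBounded

theorem le_inradius [Nontrivial (E d)] {T : Finset (E d)} {c : E d} {ρ : ℝ} (hρ : 0 ≤ ρ)
    (hc : Metric.closedBall c ρ ⊆ cell T) : ρ ≤ inradius T := by
  refine le_csSup ⟨Metric.diam (cell T), ?_⟩ ⟨hρ, c, hc⟩
  rintro ρ' ⟨hρ', c', hc'⟩
  linarith [le_diam_cell_of_closedBall_subset hρ' hc']

theorem exists_ball_subset_of_lt_inradius {T : Finset (E d)} {ρ : ℝ} (h_pos : 0 < inradius T)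
    (h : ρ < inradius T) : ∃ c : E d, Metric.ball c ρ ⊆ cell T := by
  obtain ⟨ρ', ⟨-, c, hc⟩, hρρ'⟩ := exists_lt_of_lt_csSup
    (nonempty_iff_ne_empty.2 fun h_empty => by simp [inradius, h_empty] at h_pos) h
  exact ⟨c, (Metric.ball_subset_closedBall.trans
    (Metric.closedBall_subset_closedBall hρρ'.le)).trans hc⟩

namespace SimplicialPartition

variable {Δ : SimplicialPartition d} {S T U : Finset (E d)} {k : ℕ}

theorem touches_self (hT : T ∈ Δ.simplices) : Touches T T := by
  obtain ⟨x, hx⟩ := interior_cell_nonempty hT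
  exact touches_of_mem (interior_subset hx) (interior_subset hx)

theorem mem_star_zero : S ∈ Δ.star T 0 ↔ S = T := Iff.rfl

theorem mem_simplices_of_mem_star (hT : T ∈ Δ.simplices) (hS : S ∈ Δ.star T k) :
    S ∈ Δ.simplices := by
  cases k with
  | zero => rwa [mem_star_zero.1 hS]
  | succ k => exact hS.1

theorem mem_star_succ (hU : U ∈ Δ.star T k) (hS : S ∈ Δ.simplices) (h : Touches S U) :
    S ∈ Δ.star T (k + 1) :=
  ⟨hS, U, hU, h⟩

theorem star_mono (hT : T ∈ Δ.simplices) : Monotone (Δ.star T) :=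
  monotone_nat_of_le_succ fun _ _ hS =>
    have hS' := mem_simplices_of_mem_star hT hS
    mem_star_succ hS hS' (touches_self hS')

theorem mem_starRegion_one {x : E d} :
    x ∈ Δ.starRegion T 1 ↔ ∃ S ∈ Δ.simplices, Touches S T ∧ x ∈ cell S := by
  simp [starRegion, star, and_assoc]

theorem mem_star_add_two {x : E d} (hU : U ∈ Δ.star T k) (hxU : x ∈ cell U)
    (hS : S ∈ Δ.simplices) (hxS : x ∈ Δ.starRegion S 1) : S ∈ Δ.star T (k + 2) := by
  obtain ⟨S', hS', hS'S, hxS'⟩ := mem_starRegion_one.1 hxS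
  exact mem_star_succ (mem_star_succ hU hS' (touches_of_mem hxS' hxU)) hS hS'S.symm

theorem mem_star_add_three {x : E d} (hU : U ∈ Δ.star T k) (hxU : x ∈ Δ.starRegion U 1)
    (hS : S ∈ Δ.simplices) (hxS : x ∈ Δ.starRegion S 1) : S ∈ Δ.star T (k + 3) := by
  obtain ⟨U', hU', hU'U, hxU'⟩ := mem_starRegion_one.1 hxU
  exact mem_star_add_two (mem_star_succ hU hU' hU'U) hxU' hS hxS

theorem diam_cell_le_meshSize (hT : T ∈ Δ.simplices) : Metric.diam (cell T) ≤ Δ.meshSize := by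
  have : Finite Δ.simplices := Δ.finite_simplices
  exact le_ciSup (f := fun T : Δ.simplices => Metric.diam (cell (T : Finset (E d))))
    (finite_range _).bddAbove ⟨T, hT⟩

theorem dist_le_meshSize (hT : T ∈ Δ.simplices) {x y : E d} (hx : x ∈ cell T) (hy : y ∈ cell T) :
    dist x y ≤ Δ.meshSize :=
  (Metric.dist_le_diam_of_mem (isCompact_cell T).isBounded hx hy).trans (diam_cell_le_meshSize hT)

theorem dist_le_of_mem_star (hT : T ∈ Δ.simplices) {x y : E d} (hx : x ∈ cell T)
    (hS : S ∈ Δ.star T k) (hy : y ∈ cell S) : dist y x ≤ (k + 1) * Δ.meshSize := by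
  induction k generalizing S y with
  | zero =>
    rw [mem_star_zero.1 hS] at hy
    simpa using dist_le_meshSize hT hy hx
  | succ k ih =>
    obtain ⟨hS', U, hU, z, hzS, hzU⟩ := hS
    calc dist y x ≤ dist y z + dist z x := dist_triangle y z x
      _ ≤ Δ.meshSize + (k + 1) * Δ.meshSize := add_le_add (dist_le_meshSize hS' hy hzS) (ih hU hzU)
      _ = ((k + 1 : ℕ) + 1) * Δ.meshSize := by push_cast; ring

theorem inradius_pos [Nontrivial (E d)] (hT : T ∈ Δ.simplices) : 0 < inradius T := by
  obtain ⟨x, hx⟩ := interior_cell_nonempty hT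
  obtain ⟨ε, hε, h⟩ := Metric.nhds_basis_closedBall.mem_iff.1 (mem_interior_iff_mem_nhds.1 hx)
  exact hε.trans_le (le_inradius hε.le h)

theorem meshSize_pos [Nontrivial (E d)] (hT : T ∈ Δ.simplices) : 0 < Δ.meshSize := by
  obtain ⟨x, hx⟩ := interior_cell_nonempty hT
  obtain ⟨ε, hε, h⟩ := Metric.nhds_basis_closedBall.mem_iff.1 (mem_interior_iff_mem_nhds.1 hx)
  linarith [le_diam_cell_of_closedBall_subset hε.le h, diam_cell_le_meshSize hT]

theorem disjoint_interior_cell (hT : T ∈ Δ.simplices) (hS : S ∈ Δ.simplices) (hTS : T ≠ S) :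
    Disjoint (interior (cell T)) (interior (cell S)) := by
  rw [Set.disjoint_left]
  intro x hxT hxS
  obtain ⟨v, hvT, hvS⟩ : ∃ v ∈ T, v ∉ S := by
    by_contra! h_subset
    exact hTS (Finset.eq_of_subset_of_card_le h_subset (by rw [hT.2, hS.2]))
  have h_pos : 0 < (isFullSimplex hT).coord v x := by
    rw [cell, (isFullSimplex hT).interior_convexHull] at hxT
    exact hxT v hvT
  rw [coord_eq_coord hT hS (interior_subset hxT) (interior_subset hxS),
    (isFullSimplex hS).coord_of_notMem hvS] at h_pos
  exact h_pos.false

theorem QuasiUniform.pos [Nontrivial (E d)] {β : ℝ} (h : Δ.QuasiUniform β)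
    (hT : T ∈ Δ.simplices) : 0 < β :=
  (div_pos (meshSize_pos hT) (inradius_pos hT)).trans_le (h T hT)

theorem QuasiUniform.exists_ball_subset [Nontrivial (E d)] {β : ℝ} (h : Δ.QuasiUniform β)
    (hT : T ∈ Δ.simplices) : ∃ c : E d, Metric.ball c (Δ.meshSize / (2 * β)) ⊆ cell T := by
  have hβ := h.pos hT
  have h_inradius := inradius_pos hT
  refine exists_ball_subset_of_lt_inradius h_inradius ?_
  have h_le : Δ.meshSize ≤ β * inradius T := (div_le_iff₀ h_inradius).1 (h T hT)
  rw [div_lt_iff₀ (by positivity)]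
  nlinarith [mul_pos hβ h_inradius]

theorem QuasiUniform.card_star_le [Nontrivial (E d)] {β : ℝ} (h : Δ.QuasiUniform β)
    (hT : T ∈ Δ.simplices) {𝒯 : Finset (Finset (E d))} (h𝒯 : ∀ S ∈ 𝒯, S ∈ Δ.star T k) :
    (𝒯.card : ℝ) ≤ (2 * β * (k + 1)) ^ d := by
  have hβ := h.pos hT
  have h_mesh := meshSize_pos hT
  have h_simplices : ∀ S ∈ 𝒯, S ∈ Δ.simplices := fun S hS => mem_simplices_of_mem_star hT (h𝒯 S hS)
  choose! c hc using fun S (hS : S ∈ 𝒯) => h.exists_ball_subset (h_simplices S hS)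
  obtain ⟨x, hx⟩ := interior_cell_nonempty hT
  set ρ := Δ.meshSize / (2 * β) with hρ
  have hρ_pos : 0 < ρ := by positivity
  have h_interior : ∀ S ∈ 𝒯, Metric.ball (c S) ρ ⊆ interior (cell S) := fun S hS =>
    interior_maximal (hc S hS) Metric.isOpen_ball
  have h_packing := card_mul_pow_finrank_le_of_pairwiseDisjoint_ball (s := 𝒯) (c := c) (x := x)
    (r := (k + 1) * Δ.meshSize) hρ_pos (by positivity)
    (fun S hS S' hS' hSS' => (disjoint_interior_cell (h_simplices S hS) (h_simplices S' hS')
      hSS').mono (h_interior S hS) (h_interior S' hS'))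
    (fun S hS y hy => dist_le_of_mem_star hT (interior_subset hx) (h𝒯 S hS) (hc S hS hy))
  have h_radius : (k + 1) * Δ.meshSize = 2 * β * (k + 1) * ρ := by
    rw [hρ]
    field_simp
  rw [finrank_euclideanSpace_fin, h_radius, mul_pow _ ρ] at h_packing
  exact le_of_mul_le_mul_right h_packing (by positivity)

end SimplicialPartition

/-! ### Exponential decay -/

theorem gradient_eq_zero_of_notMem_tsupport {F : Type*} [NormedAddCommGroup F]
    [InnerProductSpace ℝ F] [CompleteSpace F] {u : F → ℝ} {x : F} (hx : x ∉ tsupport u) :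
    gradient u x = 0 := by
  rw [(notMem_tsupport_iff_eventuallyEq.1 hx).gradient_eq]
  exact gradient_const x 0

theorem exists_ne_zero_of_setIntegral_mul_ne_zero {α : Type*} [MeasurableSpace α] {μ : Measure α}
    {s : Set α} {f g : α → ℝ} (h : ∫ x in s, f x * g x ∂μ ≠ 0) : ∃ x, f x ≠ 0 ∧ g x ≠ 0 := by
  by_contra! h_zero
  refine h (setIntegral_eq_zero_of_forall_eq_zero fun x _ => ?_)
  by_cases hx : f x = 0
  · rw [hx, zero_mul]
  · rw [h_zero x hx, mul_zero]

namespace SimplicialPartition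

variable {Δ : SimplicialPartition d} {T : Finset (E d)} {v : E d}

theorem cell_subset_tsupport_hat (hT : T ∈ Δ.simplices) (hv : v ∈ T) :
    cell T ⊆ tsupport (Δ.hat v) := by
  rw [← closure_interior_cell hT]
  refine closure_mono fun x hx => ?_
  rw [Function.mem_support, hat_eq_coord hT (interior_subset hx)]
  rw [cell, (isFullSimplex hT).interior_convexHull] at hx
  exact (hx v hv).ne'

theorem mem_enlargedSupport_of_hat_ne_zero {x : E d} (hx : Δ.hat v x ≠ 0) :
    x ∈ Δ.enlargedSupport (Δ.hat v) := by
  obtain ⟨T, hT, hxT⟩ := exists_cell_of_hat_ne_zero hx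
  exact mem_iUnion₂.2 ⟨T, ⟨hT, cell_subset_tsupport_hat hT (mem_of_hat_ne_zero hT hxT hx)⟩,
    mem_starRegion_one.2 ⟨T, hT, touches_self hT, hxT⟩⟩

theorem support_hat_subset_closedBall (v : E d) :
    Function.support (Δ.hat v) ⊆ Metric.closedBall v Δ.meshSize := fun x hx => by
  obtain ⟨T, hT, hxT⟩ := exists_cell_of_hat_ne_zero hx
  exact dist_le_meshSize hT hxT (mem_cell_of_mem (mem_of_hat_ne_zero hT hxT hx))

theorem abs_integral_hat_mul_le {η K : ℝ} (hη : Δ.meshSize ≤ η) (v : E d) {w : E d → ℝ}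
    (hw : ∀ x, |w x| ≤ K) :
    |∫ x in Δ.domain, Δ.hat v x * w x| ≤ K * volume.real (Metric.closedBall (0 : E d) η) := by
  have h_ball : ∀ x ∉ Metric.closedBall v η, Δ.hat v x * w x = 0 := fun x hx => by
    rw [Function.notMem_support.1 fun h =>
      hx (Metric.closedBall_subset_closedBall hη (support_hat_subset_closedBall v h)), zero_mul]
  have h_volume : volume.real (Metric.closedBall v η) =
      volume.real (Metric.closedBall (0 : E d) η) := by
    rw [measureReal_def, measureReal_def, Measure.addHaar_closedBall_center]
  rw [setIntegral_eq_integral_of_forall_compl_eq_zero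
      fun x hx => by rw [hat_of_notMem hx, zero_mul],
    ← setIntegral_eq_integral_of_forall_compl_eq_zero h_ball, ← h_volume]
  rw [← Real.norm_eq_abs]
  refine norm_setIntegral_le_of_norm_le_const measure_closedBall_lt_top fun x _ => ?_
  rw [Real.norm_eq_abs, abs_mul, abs_of_nonneg (hat_nonneg v x)]
  exact (mul_le_of_le_one_left (abs_nonneg _) (hat_le_one v x)).trans (hw x)

variable {r n m : ℕ} {B : Module.Basis (Fin m) ℝ (Δ.splineSpaceZero r n)}

section Stiffness

variable (B) in
/-- The stiffness matrix of a basis `B`: the Gram matrix of `B` for the Dirichlet form. -/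
noncomputable def stiffness : Matrix (Fin m) (Fin m) ℝ :=
  LinearMap.BilinForm.toMatrix B (Δ.dirichletForm r n)

theorem stiffness_apply (ξ ζ : Fin m) : stiffness B ξ ζ = Δ.dirichlet (B ξ) (B ζ) :=
  LinearMap.BilinForm.toMatrix_apply _ _ _ _

theorem isSymm_stiffness : (stiffness B).IsSymm :=
  Matrix.IsSymm.ext fun ξ ζ => by rw [stiffness_apply, stiffness_apply, dirichlet_comm]

theorem stiffness_mulVec_repr (u : Δ.splineSpaceZero r n) (ξ : Fin m) :
    (stiffness B *ᵥ B.repr u) ξ = Δ.dirichlet (B ξ) u := by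
  rw [← dirichletForm_apply, LinearMap.BilinForm.apply_eq_dotProduct_toMatrix_mulVec B,
    B.repr_self, Finsupp.single_eq_pi_single, single_one_dotProduct, stiffness]

theorem coe_equivFun_symm (c : Fin m → ℝ) :
    (B.equivFun.symm c : E d → ℝ) = ∑ ζ, c ζ • (B ζ : E d → ℝ) := by
  rw [B.equivFun_symm_apply]
  push_cast
  rfl

theorem dotProduct_stiffness_mulVec (c : Fin m → ℝ) :
    c ⬝ᵥ stiffness B *ᵥ c =
      Δ.dirichlet (∑ ζ, c ζ • (B ζ : E d → ℝ)) (∑ ζ, c ζ • (B ζ : E d → ℝ)) := by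
  rw [← coe_equivFun_symm, ← dirichletForm_apply, stiffness,
    LinearMap.BilinForm.dotProduct_toMatrix_mulVec]

theorem exists_mem_tsupport_of_stiffness_ne_zero {ξ ζ : Fin m} (h : stiffness B ξ ζ ≠ 0) :
    ∃ x, x ∈ tsupport (B ξ : E d → ℝ) ∧ x ∈ tsupport (B ζ : E d → ℝ) := by
  by_contra! h_disjoint
  rw [stiffness_apply] at h
  refine h (setIntegral_eq_zero_of_forall_eq_zero fun x _ => ?_)
  by_cases hx : x ∈ tsupport (B ξ : E d → ℝ)
  · rw [gradient_eq_zero_of_notMem_tsupport (h_disjoint x hx), inner_zero_right]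
  · rw [gradient_eq_zero_of_notMem_tsupport hx, inner_zero_left]

theorem IsInteriorGBC.stiffness_mulVec_repr {h : E d → ℝ} {R : Δ.splineSpaceZero r n}
    (hR : Δ.IsInteriorGBC r n h R) (ξ : Fin m) :
    (stiffness B *ᵥ B.repr R) ξ = -∫ x in Δ.domain, h x * (B ξ : E d → ℝ) x := by
  rw [SimplicialPartition.stiffness_mulVec_repr, dirichlet_comm]
  exact hR.2 _ (B ξ).2

end Stiffness

/-- An upper bound for the number of basis functions of a `1`-local basis whose simplices `T_ξ`
lie in the third star of a fixed simplex of a `β`-quasi-uniform partition: `(10 * β) ^ d` bounds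
the number of simplices in the fourth star, and on each of these the basis functions are
polynomials of degree at most `n`. -/
noncomputable def overlapBound (d n : ℕ) (β : ℝ) : ℝ :=
  (10 * β) ^ d * Module.finrank ℝ (MvPolynomial.restrictTotalDegree (Fin d) ℝ n)

namespace IsLocalBasis

variable {β η K₁ : ℝ} (hB : Δ.IsLocalBasis B K₁) {ξ ζ : Fin m} {k : ℕ} {x : E d}

/-- A simplex `T_ξ` whose first star contains the support of the basis function `B ξ`. -/
noncomputable def center (ξ : Fin m) : Finset (E d) := (hB ξ).2.choose

theorem center_mem (ξ : Fin m) : hB.center ξ ∈ Δ.simplices := (hB ξ).2.choose_spec.1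

theorem tsupport_subset (ξ : Fin m) :
    tsupport (B ξ : E d → ℝ) ⊆ Δ.starRegion (hB.center ξ) 1 := (hB ξ).2.choose_spec.2

theorem mem_starRegion_center (hx : (B ξ : E d → ℝ) x ≠ 0) :
    x ∈ Δ.starRegion (hB.center ξ) 1 :=
  hB.tsupport_subset ξ (subset_closure hx)

theorem center_mem_star_two (hT : x ∈ cell T) (hx : (B ξ : E d → ℝ) x ≠ 0) :
    hB.center ξ ∈ Δ.star T 2 :=
  mem_star_add_two (k := 0) rfl hT (hB.center_mem ξ) (hB.mem_starRegion_center hx)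

theorem center_mem_star_three (hv : v ∈ T) (hvx : Δ.hat v x ≠ 0) (hx : (B ξ : E d → ℝ) x ≠ 0) :
    hB.center ξ ∈ Δ.star T 3 := by
  obtain ⟨S, hS, hxS⟩ := exists_cell_of_hat_ne_zero hvx
  have h_touches : Touches S T :=
    touches_of_mem (mem_cell_of_mem (mem_of_hat_ne_zero hS hxS hvx)) (mem_cell_of_mem hv)
  exact mem_star_add_three (k := 0) rfl (mem_starRegion_one.2 ⟨S, hS, h_touches, hxS⟩)
    (hB.center_mem ξ) (hB.mem_starRegion_center hx)

theorem center_mem_star_add_three (hξ : hB.center ξ ∈ Δ.star T k) (h : stiffness B ξ ζ ≠ 0) :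
    hB.center ζ ∈ Δ.star T (k + 3) := by
  obtain ⟨x, hxξ, hxζ⟩ := exists_mem_tsupport_of_stiffness_ne_zero h
  exact mem_star_add_three hξ (hB.tsupport_subset ξ hxξ) (hB.center_mem ζ)
    (hB.tsupport_subset ζ hxζ)

theorem integral_hat_mul_eq_zero (hT : T ∈ Δ.simplices) {j : ℕ} (hj : j < k)
    (hξ : hB.center ξ ∈ Δ.star T j)
    (hk : Disjoint (Δ.starRegion T k) (Δ.enlargedSupport (Δ.hat v))) :
    ∫ x in Δ.domain, Δ.hat v x * (B ξ : E d → ℝ) x = 0 := by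
  by_contra h_ne
  obtain ⟨x, hvx, hx⟩ := exists_ne_zero_of_setIntegral_mul_ne_zero h_ne
  obtain ⟨S, hS, hSξ, hxS⟩ := mem_starRegion_one.1 (hB.mem_starRegion_center hx)
  have hSk : S ∈ Δ.star T k := star_mono hT hj (mem_star_succ hξ hS hSξ)
  exact hk.notMem_of_mem_left (mem_iUnion₂.2 ⟨S, hSk, hxS⟩)
    (mem_enlargedSupport_of_hat_ne_zero hvx)

variable [Nontrivial (E d)]

theorem card_le_overlapBound (hβ : Δ.QuasiUniform β) (hT : T ∈ Δ.simplices) (hk : k ≤ 3)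
    {I : Finset (Fin m)} (hI : ∀ ξ ∈ I, hB.center ξ ∈ Δ.star T k) :
    (I.card : ℝ) ≤ overlapBound d n β := by
  have h_finite : (Δ.star T 4).Finite :=
    Δ.finite_simplices.subset fun S hS => mem_simplices_of_mem_star hT hS
  set 𝒯 := h_finite.toFinset
  have h_mem (S : Finset (E d)) : S ∈ 𝒯 ↔ S ∈ Δ.star T 4 := h_finite.mem_toFinset
  have h_zero : ∀ ξ ∈ I, ∀ x, (∀ S ∈ 𝒯, x ∉ cell S) → (B ξ : E d → ℝ) x = 0 := by
    intro ξ hξ x hx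
    by_contra h_ne
    obtain ⟨S, hS, hSξ, hxS⟩ := mem_starRegion_one.1 (hB.mem_starRegion_center h_ne)
    have hS3 : hB.center ξ ∈ Δ.star T 3 := star_mono hT hk (hI ξ hξ)
    exact hx S ((h_mem S).2 (mem_star_succ hS3 hS hSξ)) hxS
  have h_indep : LinearIndependent ℝ fun ξ => (B ξ : E d → ℝ) :=
    B.linearIndependent.map' (Submodule.subtype _) (Submodule.ker_subtype _)
  have h_card := card_le_of_linearIndependent_of_polynomialOn (n := n) h_indep
    (fun ξ _ S hS => polynomialOn_of_mem_splineSpace (B ξ).2.1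
      (mem_simplices_of_mem_star hT ((h_mem S).1 hS))) h_zero
  have h_star : (𝒯.card : ℝ) ≤ (10 * β) ^ d := by
    refine (hβ.card_star_le hT fun S hS => (h_mem S).1 hS).trans_eq ?_
    norm_num
    ring
  calc (I.card : ℝ)
      ≤ 𝒯.card * Module.finrank ℝ (MvPolynomial.restrictTotalDegree (Fin d) ℝ n) := by
        exact_mod_cast h_card
    _ ≤ overlapBound d n β := by
        rw [overlapBound]
        gcongr

include hB in
theorem sum_sq_integral_hat_mul_le (hβ : Δ.QuasiUniform β) (hη : Δ.meshSize ≤ η)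
    (hT : T ∈ Δ.simplices) (hv : v ∈ T) :
    ∑ ξ, (∫ x in Δ.domain, Δ.hat v x * (B ξ : E d → ℝ) x) ^ 2 ≤
      overlapBound d n β * (K₁ * volume.real (Metric.closedBall (0 : E d) η)) ^ 2 := by
  classical
  set f : Fin m → ℝ := fun ξ => ∫ x in Δ.domain, Δ.hat v x * (B ξ : E d → ℝ) x
  set V := volume.real (Metric.closedBall (0 : E d) η)
  have h_card : ((Finset.univ.filter fun ξ => f ξ ≠ 0).card : ℝ) ≤ overlapBound d n β := by
    refine hB.card_le_overlapBound hβ hT le_rfl fun ξ hξ => ?_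
    obtain ⟨x, hvx, hx⟩ := exists_ne_zero_of_setIntegral_mul_ne_zero (Finset.mem_filter.1 hξ).2
    exact hB.center_mem_star_three hv hvx hx
  calc ∑ ξ, f ξ ^ 2 = ∑ ξ with f ξ ≠ 0, f ξ ^ 2 :=
        (Finset.sum_filter_of_ne fun ξ _ h => by simpa using h).symm
    _ ≤ ∑ ξ with f ξ ≠ 0, (K₁ * V) ^ 2 := Finset.sum_le_sum fun ξ _ =>
        sq_le_sq.2 ((abs_integral_hat_mul_le hη v (hB ξ).1).trans (le_abs_self _))
    _ = (Finset.univ.filter fun ξ => f ξ ≠ 0).card * (K₁ * V) ^ 2 := by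
        rw [Finset.sum_const, nsmul_eq_mul]
    _ ≤ overlapBound d n β * (K₁ * V) ^ 2 := by gcongr

open Classical in
theorem sq_apply_le (hβ : Δ.QuasiUniform β) (hT : T ∈ Δ.simplices) (hx : x ∈ cell T)
    (u : Δ.splineSpaceZero r n) :
    (u : E d → ℝ) x ^ 2 ≤
      overlapBound d n β * K₁ ^ 2 * ∑ ξ with hB.center ξ ∈ Δ.star T 2, B.repr u ξ ^ 2 := by
  set J : Finset (Fin m) := {ξ | hB.center ξ ∈ Δ.star T 2} with hJ
  have h_apply : (u : E d → ℝ) x = ∑ ξ ∈ J, (B ξ : E d → ℝ) x * B.repr u ξ := by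
    rw [hJ, Finset.sum_filter_of_ne fun ξ _ h =>
      hB.center_mem_star_two hx (left_ne_zero_of_mul h)]
    conv_lhs => rw [← B.equivFun.symm_apply_apply u, coe_equivFun_symm]
    simp only [B.equivFun_apply, Finset.sum_apply, Pi.smul_apply, smul_eq_mul, mul_comm]
  have h_basis : ∑ ξ ∈ J, (B ξ : E d → ℝ) x ^ 2 ≤ overlapBound d n β * K₁ ^ 2 :=
    calc ∑ ξ ∈ J, (B ξ : E d → ℝ) x ^ 2 ≤ ∑ _ξ ∈ J, K₁ ^ 2 := Finset.sum_le_sum fun ξ _ =>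
          sq_le_sq.2 (((hB ξ).1 x).trans (le_abs_self _))
      _ = J.card * K₁ ^ 2 := by rw [Finset.sum_const, nsmul_eq_mul]
      _ ≤ overlapBound d n β * K₁ ^ 2 := by
          gcongr
          exact hB.card_le_overlapBound hβ hT (k := 2) (by norm_num) fun ξ hξ => by
            simpa [hJ] using hξ
  rw [h_apply]
  refine (Finset.sum_mul_sq_le_sq_mul_sq _ _ _).trans ?_
  gcongr

end IsLocalBasis

namespace IsInteriorGBC

variable [Nontrivial (E d)] {β η K₁ C₁ C₂ q : ℝ} {R : Δ.splineSpaceZero r n} {k : ℕ}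

open Classical in
theorem sq_mul_sum_sq_repr_le (hR : Δ.IsInteriorGBC r n (Δ.hat v) R) (hβ : Δ.QuasiUniform β)
    (hη : Δ.meshSize ≤ η) (hC₁ : 0 < C₁) (hC₂ : 0 < C₂) (hq₀ : 0 ≤ q) (hq : 1 - C₁ / C₂ ≤ q)
    (hB : Δ.IsLocalBasis B K₁) (hS : Δ.IsStableBasis B C₁ C₂) (hv : v ∈ Δ.complex.vertices)
    (hT : T ∈ Δ.simplices) (hk : Disjoint (Δ.starRegion T k) (Δ.enlargedSupport (Δ.hat v))) :
    C₁ ^ 2 * ∑ ξ with hB.center ξ ∈ Δ.star T 2, B.repr R ξ ^ 2 ≤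
      q ^ (k / 3) *
        (overlapBound d n β * (K₁ * volume.real (Metric.closedBall (0 : E d) η)) ^ 2) := by
  obtain ⟨T', hT', hvT'⟩ := exists_simplex_of_mem_vertices hv
  have h_sq (c : Fin m → ℝ) : c ⬝ᵥ c = ∑ ξ, c ξ ^ 2 := by simp only [dotProduct, pow_two]
  refine (sq_mul_sum_sq_le_of_sparse (c := B.repr R) (m := k / 3)
    (lev := fun j => {ξ | hB.center ξ ∈ Δ.star T (2 + 3 * j)})
    (isSymm_stiffness (B := B)) hC₁ hC₂ (fun c => ?_) (fun c => ?_) hq₀ hq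
    (fun j _ ξ hξ ζ h => hB.center_mem_star_add_three hξ h) (fun j hj ξ hξ => ?_)
    (J := {ξ | hB.center ξ ∈ Δ.star T 2}) fun ξ hξ => (Finset.mem_filter.1 hξ).2).trans ?_
  · rw [h_sq, dotProduct_stiffness_mulVec]
    exact (hS c).1
  · rw [h_sq, dotProduct_stiffness_mulVec]
    exact (hS c).2
  · rw [hR.stiffness_mulVec_repr, hB.integral_hat_mul_eq_zero hT (by omega) hξ hk, neg_zero]
  · gcongr
    simp only [h_sq, hR.stiffness_mulVec_repr, neg_sq]
    exact hB.sum_sq_integral_hat_mul_le hβ hη hT' hvT'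

theorem abs_apply_le (hR : Δ.IsInteriorGBC r n (Δ.hat v) R) (hβ : Δ.QuasiUniform β)
    (hη : Δ.meshSize ≤ η) (hC₁ : 0 < C₁) (hC₂ : 0 < C₂) {σ : ℝ} (hσ₀ : 0 < σ) (hσ₁ : σ ≤ 1)
    (hσ : 1 - C₁ / C₂ ≤ σ ^ 6) (hB : Δ.IsLocalBasis B K₁) (hS : Δ.IsStableBasis B C₁ C₂)
    (hv : v ∈ Δ.complex.vertices) (hT : T ∈ Δ.simplices) {x : E d} (hx : x ∈ cell T)
    (hk : Disjoint (Δ.starRegion T k) (Δ.enlargedSupport (Δ.hat v))) :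
    |(R : E d → ℝ) x| ≤ overlapBound d n β * K₁ ^ 2 *
      volume.real (Metric.closedBall (0 : E d) η) / (C₁ * σ ^ 2) * σ ^ k := by
  classical
  set V := volume.real (Metric.closedBall (0 : E d) η)
  set N := overlapBound d n β with hN
  have hβ₀ := hβ.pos hT
  have hN₀ : 0 ≤ N := by rw [hN, overlapBound]; positivity
  have h_sq : C₁ ^ 2 * (R : E d → ℝ) x ^ 2 ≤ (σ ^ 6) ^ (k / 3) * (N * K₁ ^ 2 * V) ^ 2 :=
    calc C₁ ^ 2 * (R : E d → ℝ) x ^ 2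
        ≤ C₁ ^ 2 * (N * K₁ ^ 2 * ∑ ξ with hB.center ξ ∈ Δ.star T 2, B.repr R ξ ^ 2) := by
          gcongr
          exact hB.sq_apply_le hβ hT hx R
      _ = N * K₁ ^ 2 * (C₁ ^ 2 * ∑ ξ with hB.center ξ ∈ Δ.star T 2, B.repr R ξ ^ 2) := by ring
      _ ≤ N * K₁ ^ 2 * ((σ ^ 6) ^ (k / 3) * (N * (K₁ * V) ^ 2)) := by
          refine mul_le_mul_of_nonneg_left ?_ (by positivity)
          exact hR.sq_mul_sum_sq_repr_le hβ hη hC₁ hC₂ (by positivity) hσ hB hS hv hT hk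
      _ = (σ ^ 6) ^ (k / 3) * (N * K₁ ^ 2 * V) ^ 2 := by ring
  have h_pow : (σ ^ 6) ^ (k / 3) * (σ ^ 2) ^ 2 ≤ (σ ^ k) ^ 2 := by
    simp only [← pow_mul, ← pow_add]
    exact pow_le_pow_of_le_one hσ₀.le hσ₁ (by omega)
  refine abs_le_of_sq_le_sq ?_ (by positivity)
  rw [div_mul_eq_mul_div, div_pow, le_div_iff₀ (by positivity)]
  calc (R : E d → ℝ) x ^ 2 * (C₁ * σ ^ 2) ^ 2
      = C₁ ^ 2 * (R : E d → ℝ) x ^ 2 * (σ ^ 2) ^ 2 := by ring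
    _ ≤ (σ ^ 6) ^ (k / 3) * (N * K₁ ^ 2 * V) ^ 2 * (σ ^ 2) ^ 2 := by gcongr
    _ = (N * K₁ ^ 2 * V) ^ 2 * ((σ ^ 6) ^ (k / 3) * (σ ^ 2) ^ 2) := by ring
    _ ≤ (N * K₁ ^ 2 * V) ^ 2 * (σ ^ k) ^ 2 := by gcongr
    _ = (N * K₁ ^ 2 * V * σ ^ k) ^ 2 := by ring

end IsInteriorGBC

end SimplicialPartition

theorem exists_decay_rate (κ : ℝ) : ∃ σ : ℝ, 0 < σ ∧ σ < 1 ∧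
    ∀ C₁ C₂ : ℝ, 0 < C₁ → 0 < C₂ → C₂ / C₁ ≤ κ → 1 - C₁ / C₂ ≤ σ ^ 6 := by
  set q : ℝ := 1 - (max κ 2)⁻¹ with hq
  have h_inv : (max κ 2)⁻¹ ≤ 2⁻¹ := inv_anti₀ two_pos (le_max_right _ _)
  have h_inv_pos : 0 < (max κ 2)⁻¹ := by positivity
  have hq₀ : 0 < q := by linarith
  refine ⟨q ^ ((6 : ℕ) : ℝ)⁻¹, Real.rpow_pos_of_pos hq₀ _,
    Real.rpow_lt_one hq₀.le (by linarith) (by positivity), fun C₁ C₂ hC₁ hC₂ hκ => ?_⟩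
  rw [Real.rpow_inv_natCast_pow hq₀.le (by norm_num), hq, ← inv_div C₂ C₁]
  exact sub_le_sub_left (inv_anti₀ (by positivity) (hκ.trans (le_max_left _ _))) 1

/-! ### A local basis of continuous splines -/

section Homogenization

variable {σ τ R : Type*} [Fintype σ] [CommSemiring R] {n : ℕ} {p : MvPolynomial σ R}
  {s : MvPolynomial τ R} {Y : σ → MvPolynomial τ R}

/-- The homogenization of `p` to degree `n`, with `s` substituted for the homogenizing variable
and `Y i` for the `i`-th variable of `p`; only meaningful when `p` has degree at most `n`. -/
noncomputable def homogenize (n : ℕ) (p : MvPolynomial σ R) (s : MvPolynomial τ R)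
    (Y : σ → MvPolynomial τ R) : MvPolynomial τ R :=
  ∑ m ∈ p.support, MvPolynomial.C (p.coeff m) * (∏ i, Y i ^ m i) * s ^ (n - m.degree)

theorem totalDegree_homogenize_le (hp : p.totalDegree ≤ n) (hs : s.totalDegree ≤ 1)
    (hY : ∀ i, (Y i).totalDegree ≤ 1) : (homogenize n p s Y).totalDegree ≤ n := by
  refine MvPolynomial.totalDegree_finsetSum_le fun m hm => ?_
  have h_pow {q : MvPolynomial τ R} (hq : q.totalDegree ≤ 1) (k : ℕ) :
      (q ^ k).totalDegree ≤ k := by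
    simpa using (MvPolynomial.totalDegree_pow q k).trans (Nat.mul_le_mul_left k hq)
  have h_prod : (∏ i, Y i ^ m i).totalDegree ≤ m.degree :=
    calc (∏ i, Y i ^ m i).totalDegree ≤ ∑ i, (Y i ^ m i).totalDegree :=
          MvPolynomial.totalDegree_finsetProd _ _
      _ ≤ ∑ i, m i := Finset.sum_le_sum fun i _ => h_pow (hY i) (m i)
      _ = m.degree := (Finsupp.degree_eq_sum m).symm
  have h_degree : m.degree ≤ n := (MvPolynomial.le_totalDegree hm).trans hp
  calc _ ≤ (MvPolynomial.C (p.coeff m)).totalDegree + (∏ i, Y i ^ m i).totalDegree +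
          (s ^ (n - m.degree)).totalDegree :=
        (MvPolynomial.totalDegree_mul _ _).trans
          (Nat.add_le_add_right (MvPolynomial.totalDegree_mul _ _) _)
    _ ≤ 0 + m.degree + (n - m.degree) := by
        rw [MvPolynomial.totalDegree_C]
        gcongr
        exact h_pow hs _
    _ = n := by omega

theorem eval_homogenize_of_eq_zero (hn : n ≠ 0) {x : τ → R} (hs : MvPolynomial.eval x s = 0)
    (hY : ∀ i, MvPolynomial.eval x (Y i) = 0) : MvPolynomial.eval x (homogenize n p s Y) = 0 := by
  rw [homogenize, map_sum]
  refine Finset.sum_eq_zero fun m _ => ?_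
  simp only [map_mul, map_prod, map_pow, hs, hY, Finset.prod_pow_eq_pow_sum,
    ← Finsupp.degree_eq_sum]
  rcases eq_or_ne m.degree 0 with hm | hm
  · rw [hm, Nat.sub_zero, zero_pow hn, mul_zero]
  · rw [zero_pow hm, mul_zero, zero_mul]

theorem eval_homogenize {K : Type*} [Field K] {p : MvPolynomial σ K} {s : MvPolynomial τ K}
    {Y : σ → MvPolynomial τ K} (hp : p.totalDegree ≤ n) {x : τ → K}
    (hs : MvPolynomial.eval x s ≠ 0) :
    MvPolynomial.eval x (homogenize n p s Y) = MvPolynomial.eval x s ^ n *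
      MvPolynomial.eval (fun i => (MvPolynomial.eval x s)⁻¹ * MvPolynomial.eval x (Y i)) p := by
  rw [homogenize, MvPolynomial.eval_eq' _ p, Finset.mul_sum, map_sum]
  refine Finset.sum_congr rfl fun m hm => ?_
  have h_degree : m.degree ≤ n := (MvPolynomial.le_totalDegree hm).trans hp
  simp only [map_mul, MvPolynomial.eval_C, map_prod, map_pow, mul_pow, Finset.prod_mul_distrib,
    Finset.prod_pow_eq_pow_sum, ← Finsupp.degree_eq_sum]
  rw [pow_sub₀ _ hs h_degree, inv_pow]
  ring

end Homogenization

variable {n : ℕ}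

namespace PolynomialOn

variable {s t : Set (E d)}

theorem sum_mul {ι : Type*} {I : Finset ι} {f : ι → E d → ℝ}
    (hf : ∀ i ∈ I, PolynomialOn n s (f i)) (c : ι → ℝ) :
    PolynomialOn n s fun x => ∑ i ∈ I, f i x * c i := by
  choose! p hpn hp using hf
  refine ⟨∑ i ∈ I, c i • p i, MvPolynomial.totalDegree_finsetSum_le fun i hi =>
    (MvPolynomial.totalDegree_smul_le _ _).trans (hpn i hi), fun x hx => ?_⟩
  simp only [map_sum, MvPolynomial.smul_eval]
  exact Finset.sum_congr rfl fun i hi => by rw [hp i hi x hx, mul_comm]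

theorem pow_mul_apply_inv_smul (hn : n ≠ 0) {u a : E d → ℝ} {b : E d → E d}
    (hu : PolynomialOn n t u) (ha : PolynomialOn 1 s a)
    (hb : ∀ i, PolynomialOn 1 s fun x => b x i) (hab : ∀ x ∈ s, a x = 0 → b x = 0)
    (ht : ∀ x ∈ s, a x ≠ 0 → (a x)⁻¹ • b x ∈ t) :
    PolynomialOn n s fun x => a x ^ n * u ((a x)⁻¹ • b x) := by
  obtain ⟨p, hpn, hp⟩ := hu
  obtain ⟨q, hq, hqa⟩ := ha
  choose Y hY hYb using hb
  refine ⟨homogenize n p q Y, totalDegree_homogenize_le hpn hq hY, fun x hx => ?_⟩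
  beta_reduce
  rcases eq_or_ne (a x) 0 with h_zero | h_ne
  · rw [h_zero, zero_pow hn, zero_mul, eval_homogenize_of_eq_zero hn]
    · rw [← hqa x hx, h_zero]
    · exact fun i => by simp only [← hYb i x hx, hab x hx h_zero, PiLp.zero_apply]
  · rw [eval_homogenize hpn (by rwa [← hqa x hx]), hp _ (ht x hx h_ne), ← hqa x hx]
    simp only [← hYb _ x hx, PiLp.smul_apply, smul_eq_mul]

end PolynomialOn

namespace SimplicialPartition

variable {Δ : SimplicialPartition d} {T A : Finset (E d)} {x v : E d}

theorem polynomialOn_hat (hT : T ∈ Δ.simplices) (v : E d) :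
    PolynomialOn 1 (cell T) (Δ.hat v) :=
  (polynomialOn_affineMap _ _).congr fun _ hx => hat_eq_coord hT hx v

theorem sum_hat_eq_one (hT : T ∈ Δ.simplices) (hx : x ∈ cell T) (hA : T ⊆ A) :
    ∑ v ∈ A, Δ.hat v x = 1 := by
  rw [← Finset.sum_subset hA fun v _ hv => of_not_not fun h => hv (mem_of_hat_ne_zero hT hx h)]
  simp only [hat_eq_coord hT hx, (isFullSimplex hT).sum_coord]

theorem sum_hat_smul_eq_self (hT : T ∈ Δ.simplices) (hx : x ∈ cell T) (hA : T ⊆ A) :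
    ∑ v ∈ A, Δ.hat v x • v = x := by
  have h_zero : ∀ v ∈ A, v ∉ T → Δ.hat v x • v = 0 := fun v _ hv => by
    rw [of_not_not fun h => hv (mem_of_hat_ne_zero hT hx h), zero_smul]
  rw [← Finset.sum_subset hA h_zero]
  simp only [hat_eq_coord hT hx, (isFullSimplex hT).sum_coord_smul]

variable (Δ) in
/-- The projection onto the subcomplex spanned by the vertices in `A`: drop the barycentric
coordinates of all other vertices and renormalize.  The value is `0` where the barycentric
coordinates of the vertices in `A` all vanish. -/
noncomputable def proj (A : Finset (E d)) (x : E d) : E d := A.centerMass (Δ.hat · x) id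

theorem proj_mem_convexHull (hA : ∑ v ∈ A, Δ.hat v x ≠ 0) :
    Δ.proj A x ∈ convexHull ℝ {v | Δ.hat v x ≠ 0} := by
  classical
  rw [proj, ← Finset.centerMass_filter_ne_zero]
  refine Finset.centerMass_mem_convexHull _ (fun v _ => hat_nonneg v x) ?_
    fun v hv => (Finset.mem_filter.1 hv).2
  rw [Finset.sum_filter_ne_zero]
  exact (Finset.sum_nonneg fun v _ => hat_nonneg v x).lt_of_ne' hA

theorem proj_mem_cell (hT : T ∈ Δ.simplices) (hx : x ∈ cell T) (hA : ∑ v ∈ A, Δ.hat v x ≠ 0) :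
    Δ.proj A x ∈ cell T :=
  convexHull_mono (fun _ hv => mem_of_hat_ne_zero hT hx hv) (proj_mem_convexHull hA)

theorem hat_proj_eq_zero (hA : ∑ v ∈ A, Δ.hat v x ≠ 0) (hv : Δ.hat v x = 0) :
    Δ.hat v (Δ.proj A x) = 0 := by
  obtain ⟨w, -, hw⟩ := Finset.exists_ne_zero_of_sum_ne_zero hA
  obtain ⟨T, hT, hx⟩ := exists_cell_of_hat_ne_zero hw
  have h_vertices : {w | Δ.hat w x ≠ 0} ⊆ (isFullSimplex hT).coord v ⁻¹' {0} := fun w hw =>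
    (isFullSimplex hT).coord_of_ne (mem_of_hat_ne_zero hT hx hw) fun h => hw (h ▸ hv)
  rw [hat_eq_coord hT (proj_mem_cell hT hx hA)]
  exact convexHull_min h_vertices ((convex_singleton 0).affine_preimage _) (proj_mem_convexHull hA)

variable (Δ) in
/-- The extension of `u` from the subcomplex spanned by the vertices in `A` that is homogeneous
of degree `n` in the barycentric coordinates. -/
noncomputable def homogExt (n : ℕ) (A : Finset (E d)) (u : E d → ℝ) (x : E d) : ℝ :=
  (∑ v ∈ A, Δ.hat v x) ^ n * u (Δ.proj A x)

theorem homogExt_eq_zero (hn : n ≠ 0) (hA : ∑ v ∈ A, Δ.hat v x = 0) (u : E d → ℝ) :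
    Δ.homogExt n A u x = 0 := by
  rw [homogExt, hA, zero_pow hn, zero_mul]

theorem homogExt_insert_eq [DecidableEq (E d)] (hv : Δ.hat v x = 0) (u : E d → ℝ) :
    Δ.homogExt n (insert v A) u x = Δ.homogExt n A u x := by
  have h_sum : ∑ w ∈ insert v A, Δ.hat w x • id w = ∑ w ∈ A, Δ.hat w x • id w :=
    Finset.sum_insert_of_eq_zero_if_notMem fun _ => by rw [hv, zero_smul]
  have h_weight : ∑ w ∈ insert v A, Δ.hat w x = ∑ w ∈ A, Δ.hat w x :=
    Finset.sum_insert_of_eq_zero_if_notMem fun _ => hv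
  rw [homogExt, homogExt, proj, proj, Finset.centerMass, Finset.centerMass, h_sum, h_weight]

theorem homogExt_eq_self (hT : T ∈ Δ.simplices) (hx : x ∈ cell T) (hA : T ⊆ A) (u : E d → ℝ) :
    Δ.homogExt n A u x = u x := by
  rw [homogExt, proj, Finset.centerMass, sum_hat_eq_one hT hx hA]
  simp only [id, sum_hat_smul_eq_self hT hx hA, one_pow, one_mul, inv_one, one_smul]

theorem polynomialOn_homogExt (hn : n ≠ 0) (A : Finset (E d)) {u : E d → ℝ}
    (hT : T ∈ Δ.simplices) (hu : PolynomialOn n (cell T) u) :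
    PolynomialOn n (cell T) (Δ.homogExt n A u) := by
  have h_weight : PolynomialOn 1 (cell T) fun x => ∑ v ∈ A, Δ.hat v x := by
    simpa only [mul_one] using
      PolynomialOn.sum_mul (fun v _ => polynomialOn_hat hT v) fun _ : E d => (1 : ℝ)
  refine hu.pow_mul_apply_inv_smul hn h_weight (fun i => ?_) (fun x _ hA => ?_)
    fun x hx hA => proj_mem_cell hT hx hA
  · simp only [id, WithLp.ofLp_sum, Finset.sum_apply, PiLp.smul_apply, smul_eq_mul]
    exact PolynomialOn.sum_mul (fun v _ => polynomialOn_hat hT v) fun v => v i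
  · have h_zero := (Finset.sum_eq_zero_iff_of_nonneg fun v _ => hat_nonneg v x).1 hA
    exact Finset.sum_eq_zero fun v hv => smul_eq_zero_of_left (h_zero v hv) v

theorem homogExt_mem_splineSpaceZero (hn : n ≠ 0) (A : Finset (E d)) {u : E d → ℝ}
    (hu : u ∈ Δ.splineSpaceZero 0 n) : Δ.homogExt n A u ∈ Δ.splineSpaceZero 0 n := by
  refine ⟨mem_splineSpace_zero (fun T hT => polynomialOn_homogExt hn A hT
    (polynomialOn_of_mem_splineSpace hu.1 hT)) fun x hx => homogExt_eq_zero hn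
      (Finset.sum_eq_zero fun v _ => hat_of_notMem hx v) u, fun x hx => ?_⟩
  obtain ⟨T, hT, hxT⟩ := mem_domain_iff.1 (Δ.isCompact_domain.isClosed.frontier_subset hx)
  by_cases hA : ∑ v ∈ A, Δ.hat v x = 0
  · exact homogExt_eq_zero hn hA u
  · rw [homogExt, eq_zero_of_mem_frontier hu (mem_frontier_of_carrier_subset hT hxT
      (proj_mem_cell hT hxT hA) hx fun v => hat_proj_eq_zero hA), mul_zero]

theorem exists_homogExt_eq_self (Δ : SimplicialPartition d) (hn : n ≠ 0) :
    ∃ A : Finset (E d), ∀ u ∈ Δ.splineSpaceZero 0 n, Δ.homogExt n A u = u := by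
  classical
  refine ⟨Δ.finite_simplices.toFinset.biUnion id, fun u hu => funext fun x => ?_⟩
  by_cases hx : x ∈ Δ.domain
  · obtain ⟨T, hT, hxT⟩ := mem_domain_iff.1 hx
    exact homogExt_eq_self hT hxT
      (Finset.subset_biUnion_of_mem id (Δ.finite_simplices.mem_toFinset.2 hT)) u
  · rw [eq_zero_of_notMem_domain hu.1 hx,
      homogExt_eq_zero hn (Finset.sum_eq_zero fun v _ => hat_of_notMem hx v)]

variable (Δ n) in
/-- The admissible members of a `1`-local basis with bound `1`. -/
def localSplines : Set (Δ.splineSpaceZero 0 n) :=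
  {w | (∀ x, |(w : E d → ℝ) x| ≤ 1) ∧
    ∃ T ∈ Δ.simplices, tsupport (w : E d → ℝ) ⊆ Δ.starRegion T 1}

theorem isClosed_starRegion_one (T : Finset (E d)) : IsClosed (Δ.starRegion T 1) :=
  (Δ.finite_simplices.subset fun _ hS => hS.1).isClosed_biUnion
    fun S _ => (isCompact_cell S).isClosed

theorem exists_abs_le_of_mem_splineSpaceZero {r : ℕ} {u : E d → ℝ}
    (hu : u ∈ Δ.splineSpaceZero r n) : ∃ M, ∀ x, |u x| ≤ M :=
  (continuous_of_mem_splineSpaceZero hu).bounded_above_of_compact_support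
    (HasCompactSupport.intro Δ.isCompact_domain fun _ hx => eq_zero_of_notMem_domain hu.1 hx)

theorem mem_span_localSplines_of_tsupport_subset {w : Δ.splineSpaceZero 0 n}
    (hT : T ∈ Δ.simplices) (hw : tsupport (w : E d → ℝ) ⊆ Δ.starRegion T 1) :
    w ∈ Submodule.span ℝ (Δ.localSplines n) := by
  obtain ⟨M, hM⟩ := exists_abs_le_of_mem_splineSpaceZero w.2
  have hM₀ : 0 < |M| + 1 := by positivity
  have h_local : (|M| + 1)⁻¹ • w ∈ Δ.localSplines n := by
    refine ⟨fun x => ?_, T, hT, (closure_mono fun x hx => ?_).trans hw⟩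
    · change |(|M| + 1)⁻¹ * (w : E d → ℝ) x| ≤ 1
      rw [abs_mul, abs_of_pos (inv_pos.2 hM₀), inv_mul_le_iff₀ hM₀, mul_one]
      exact ((hM x).trans (le_abs_self M)).trans (lt_add_one _).le
    · exact right_ne_zero_of_mul (a := (|M| + 1)⁻¹) hx
  rw [← smul_inv_smul₀ hM₀.ne' w]
  exact Submodule.smul_mem _ _ (Submodule.subset_span h_local)

theorem mem_span_localSplines_of_hat {w : Δ.splineSpaceZero 0 n}
    (hw : ∀ x, Δ.hat v x = 0 → (w : E d → ℝ) x = 0) :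
    w ∈ Submodule.span ℝ (Δ.localSplines n) := by
  by_cases hv : ∃ T ∈ Δ.simplices, v ∈ T
  · obtain ⟨T, hT, hvT⟩ := hv
    refine mem_span_localSplines_of_tsupport_subset hT
      (closure_minimal (fun x hx => ?_) (isClosed_starRegion_one T))
    have hvx : Δ.hat v x ≠ 0 := mt (hw x) hx
    obtain ⟨S, hS, hxS⟩ := exists_cell_of_hat_ne_zero hvx
    exact mem_starRegion_one.2 ⟨S, hS, touches_of_mem
      (mem_cell_of_mem (mem_of_hat_ne_zero hS hxS hvx)) (mem_cell_of_mem hvT), hxS⟩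
  · have h_zero : w = 0 := by
      refine Subtype.ext (funext fun x => hw x (of_not_not fun hvx => hv ?_))
      obtain ⟨T, hT, hxT⟩ := exists_cell_of_hat_ne_zero hvx
      exact ⟨T, hT, mem_of_hat_ne_zero hT hxT hvx⟩
    rw [h_zero]
    exact Submodule.zero_mem _

theorem homogExt_mem_span_localSplines (hn : n ≠ 0) {u : E d → ℝ}
    (hu : u ∈ Δ.splineSpaceZero 0 n) (A : Finset (E d)) :
    (⟨_, homogExt_mem_splineSpaceZero hn A hu⟩ : Δ.splineSpaceZero 0 n) ∈
      Submodule.span ℝ (Δ.localSplines n) := by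
  classical
  induction A using Finset.induction_on with
  | empty =>
    convert Submodule.zero_mem (Submodule.span ℝ (Δ.localSplines n))
    exact funext fun x => homogExt_eq_zero hn Finset.sum_empty u
  | insert v A _ ih =>
    rw [← sub_add_cancel
      (⟨_, homogExt_mem_splineSpaceZero hn (insert v A) hu⟩ : Δ.splineSpaceZero 0 n)
      ⟨_, homogExt_mem_splineSpaceZero hn A hu⟩]
    exact Submodule.add_mem _ (mem_span_localSplines_of_hat fun x hx =>
      sub_eq_zero.2 (homogExt_insert_eq hx u)) ih

theorem span_localSplines (hn : n ≠ 0) : Submodule.span ℝ (Δ.localSplines n) = ⊤ := by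
  refine eq_top_iff.2 fun u _ => ?_
  obtain ⟨A, hA⟩ := Δ.exists_homogExt_eq_self hn
  convert homogExt_mem_span_localSplines hn u.2 A
  exact (hA u u.2).symm

theorem exists_isLocalBasis_one (Δ : SimplicialPartition d) (hn : n ≠ 0) :
    ∃ (m : ℕ) (B : Module.Basis (Fin m) ℝ (Δ.splineSpaceZero 0 n)), Δ.IsLocalBasis B 1 := by
  have h_span := (span_localSplines (Δ := Δ) hn).ge
  let B := Module.Basis.ofSpan h_span
  have := FiniteDimensional.fintypeBasisIndex B
  refine ⟨_, B.reindex (Fintype.equivFin _), fun ξ => ?_⟩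
  rw [Module.Basis.reindex_apply]
  exact Module.Basis.ofSpan_subset h_span ⟨_, rfl⟩

theorem exists_isStableBasis [Nontrivial (E d)] {r m : ℕ}
    (B : Module.Basis (Fin m) ℝ (Δ.splineSpaceZero r n)) :
    ∃ C₁ C₂ : ℝ, 0 < C₁ ∧ 0 < C₂ ∧ Δ.IsStableBasis B C₁ C₂ := by
  let f : E m → ℝ := fun c => c.ofLp ⬝ᵥ stiffness B *ᵥ c.ofLp
  have hf : Continuous f := by
    simp only [f, dotProduct, mulVec]
    fun_prop
  have h_smul (t : ℝ) (c : E m) : f (t • c) = t ^ 2 * f c := by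
    simp only [f, WithLp.ofLp_smul, Matrix.mulVec_smul, smul_dotProduct, dotProduct_smul,
      smul_eq_mul]
    ring
  have h_pos : ∀ c ≠ 0, 0 < f c := fun c hc => by
    simp only [f, dotProduct_stiffness_mulVec, ← coe_equivFun_symm]
    refine (dirichlet_self_nonneg _).lt_of_ne' fun h_energy => hc ?_
    have h_zero := eq_zero_of_dirichlet_self_eq_zero (B.equivFun.symm c.ofLp).2 h_energy
    exact WithLp.ofLp_injective 2 ((LinearEquiv.map_eq_zero_iff _).1 (Subtype.ext h_zero))
  obtain ⟨C₁, C₂, hC₁, hC₂, h_bounds⟩ := exists_mul_norm_sq_bounds hf h_smul h_pos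
  refine ⟨C₁, C₂, hC₁, hC₂, fun c => ?_⟩
  rw [← dotProduct_stiffness_mulVec]
  simpa only [EuclideanSpace.real_norm_sq_eq] using h_bounds (WithLp.toLp 2 c)

end SimplicialPartition

end GBC

theorem mainTheorem3_general :
    (∀ d : ℕ, 1 ≤ d → ∀ Δ : GBC.SimplicialPartition d, ∀ v ∈ Δ.complex.vertices,
      (∃! h, Δ.IsHat v h) ∧
      ∀ r n : ℕ, ∀ h, Δ.IsHat v h → ∃! R, Δ.IsInteriorGBC r n h R) ∧
    (∀ d n : ℕ, 1 ≤ d → 1 ≤ n → ∀ Δ : GBC.SimplicialPartition d,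
      ∃ (m : ℕ) (B : Module.Basis (Fin m) ℝ (Δ.splineSpaceZero 0 n)) (C₁ C₂ : ℝ),
        0 < C₁ ∧ 0 < C₂ ∧ Δ.IsLocalBasis B 1 ∧ Δ.IsStableBasis B C₁ C₂) ∧
    ∀ κ : ℝ, ∃ σ : ℝ, 0 < σ ∧ σ < 1 ∧
      ∀ (d r n : ℕ) (β η K₁ C₁ C₂ : ℝ), 1 ≤ d → 0 < C₁ → 0 < C₂ → C₂ / C₁ ≤ κ →
        ∃ K : ℝ, 0 < K ∧
          ∀ Δ : GBC.SimplicialPartition d, Δ.QuasiUniform β → Δ.meshSize ≤ η →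
            ∀ (m : ℕ) (B : Module.Basis (Fin m) ℝ (Δ.splineSpaceZero r n)),
              Δ.IsLocalBasis B K₁ → Δ.IsStableBasis B C₁ C₂ →
              ∀ vᵢ ∈ Δ.complex.vertices, ∀ h R : GBC.E d → ℝ,
                Δ.IsHat vᵢ h → Δ.IsInteriorGBC r n h R →
                ∀ T ∈ Δ.simplices, ∀ v ∈ GBC.cell T, ∀ k : ℕ,
                  Disjoint (Δ.starRegion T k) (Δ.enlargedSupport h) → |R v| ≤ K * σ ^ k := by
  have h_nontrivial {d : ℕ} (hd : 1 ≤ d) : Nontrivial (GBC.E d) :=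
    have : Nonempty (Fin d) := ⟨⟨0, hd⟩⟩
    inferInstance
  refine ⟨fun d hd Δ v hv => ?_, fun d n hd hn Δ => ?_, fun κ => ?_⟩
  · have := h_nontrivial hd
    exact ⟨GBC.SimplicialPartition.existsUnique_isHat hv, fun _ _ _ hh =>
      GBC.SimplicialPartition.existsUnique_isInteriorGBC hh.1.1⟩
  · have := h_nontrivial hd
    obtain ⟨m, B, hB⟩ := Δ.exists_isLocalBasis_one (Nat.one_le_iff_ne_zero.1 hn)
    obtain ⟨C₁, C₂, hC₁, hC₂, hS⟩ := GBC.SimplicialPartition.exists_isStableBasis B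
    exact ⟨m, B, C₁, C₂, hC₁, hC₂, hB, hS⟩
  · obtain ⟨σ, hσ₀, hσ₁, hσ⟩ := GBC.exists_decay_rate κ
    refine ⟨σ, hσ₀, hσ₁, fun d r n β η K₁ C₁ C₂ hd hC₁ hC₂ hκ => ?_⟩
    have := h_nontrivial hd
    set K := GBC.SimplicialPartition.overlapBound d n β * K₁ ^ 2 *
      volume.real (Metric.closedBall (0 : GBC.E d) η) / (C₁ * σ ^ 2)
    refine ⟨|K| + 1, by positivity, fun Δ hβ hη m B hB hS vᵢ hvᵢ h R hh hR T hT v hv k hk => ?_⟩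
    obtain rfl := hh.eq_hat
    lift R to Δ.splineSpaceZero r n using hR.1
    refine (hR.abs_apply_le hβ hη hC₁ hC₂ hσ₀ hσ₁.le (hσ C₁ C₂ hC₁ hC₂ hκ) hB hS hvᵢ hT hv
      hk).trans ?_
    gcongr
    exact (le_abs_self K).trans (lt_add_one _).le

theorem mainTheorem3 :
    -- the hat functions and the discrete interior GBC functions exist and are unique
    (∀ (d : ℕ), 2 ≤ d → ∀ (Δ : GBC.SimplicialPartition d), ∀ v ∈ Δ.interiorVertices,
      (∃! h, Δ.IsHat v h) ∧
      ∀ (r n : ℕ), 1 ≤ n → ∀ h, Δ.IsHat v h → ∃! R, Δ.IsInteriorGBC r n h R) ∧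
    -- continuous splines always have a stable 1-local basis
    (∀ (d n : ℕ), 2 ≤ d → 1 ≤ n → ∀ (Δ : GBC.SimplicialPartition d),
      ∃ (m : ℕ) (B : Module.Basis (Fin m) ℝ (Δ.splineSpaceZero 0 n)) (C₁ C₂ : ℝ),
        0 < C₁ ∧ 0 < C₂ ∧ Δ.IsLocalBasis B 1 ∧ Δ.IsStableBasis B C₁ C₂) ∧
    -- the decay estimate: `σ` depends only on (a bound `κ` of) the ratio `C₂ / C₁`
    ∀ κ : ℝ, ∃ σ : ℝ, 0 < σ ∧ σ < 1 ∧
      ∀ (d r n : ℕ) (β η K₁ C₁ C₂ : ℝ), 2 ≤ d → 1 ≤ n → 0 < C₁ → 0 < C₂ → C₂ / C₁ ≤ κ →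
        ∃ K : ℝ, 0 < K ∧
          ∀ (Δ : GBC.SimplicialPartition d), Δ.QuasiUniform β → Δ.meshSize ≤ η →
            ∀ (m : ℕ) (B : Module.Basis (Fin m) ℝ (Δ.splineSpaceZero r n)),
              Δ.IsLocalBasis B K₁ → Δ.IsStableBasis B C₁ C₂ →
              ∀ vᵢ ∈ Δ.interiorVertices, ∀ h R : GBC.E d → ℝ,
                Δ.IsHat vᵢ h → Δ.IsInteriorGBC r n h R →
                ∀ v ∈ Δ.domain, v ∉ Δ.enlargedSupport h →
                  ∀ T ∈ Δ.simplices, v ∈ GBC.cell T →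
                    ∀ k L : ℕ, 1 ≤ k →
                      Δ.starRegion T k ⊆ Δ.domain \ Δ.enlargedSupport h →
                      Δ.IsSimplicesAway T L →
                      |R v| ≤ K * (L + 1) * σ ^ k := by
  obtain ⟨h_unique, h_basis, h_decay⟩ := mainTheorem3_general
  refine ⟨fun d hd Δ v hv => ?_, fun d n hd => h_basis d n (one_le_two.trans hd), fun κ => ?_⟩
  · obtain ⟨h_hat, h_gbc⟩ := h_unique d (one_le_two.trans hd) Δ v hv.1
    exact ⟨h_hat, fun r n _ => h_gbc r n⟩
  · obtain ⟨σ, hσ₀, hσ₁, h_bound⟩ := h_decay κ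
    refine ⟨σ, hσ₀, hσ₁, fun d r n β η K₁ C₁ C₂ hd _ hC₁ hC₂ hκ => ?_⟩
    obtain ⟨K, hK, hKR⟩ := h_bound d r n β η K₁ C₁ C₂ (one_le_two.trans hd) hC₁ hC₂ hκ
    refine ⟨K, hK, fun Δ hβ hη m B hB hS vᵢ hvᵢ h R hh hR v _ _ T hT hv k L _ hk _ => ?_⟩
    refine (hKR Δ hβ hη m B hB hS vᵢ hvᵢ.1 h R hh hR T hT v hv k
      (disjoint_sdiff_left.mono_left hk)).trans ?_
    gcongr
    exact le_mul_of_one_le_right hK.le (le_add_of_nonneg_left L.cast_nonneg)
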